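/- For $x,y\in\mathbb R$ put $\operatorname{dist}(x,y)=0$ if $x=y=0$, $\operatorname{dist}(x,y)=|\log(y/x)|$ if $xy>0$, and $\operatorname{dist}(x,y)=\infty$ otherwise. For $S\subseteq\mathbb R$, $f:S\to\mathbb R$ and $x\in S$ let $$\kappa(f,x)=\lim_{\varepsilon\to0^+}\ \sup_{y\in S,\ \operatorname{dist}(x,y)\le\varepsilon}\frac{\operatorname{dist}(f(x),f(y))}{\operatorname{dist}(x,y)}\in[0,\infty]\quad(\text{with }0/0=0),\qquad \mu(f,x)=1+\kappa(f,x).$$ The function $f$ is *amenable* on $S$ if there is a constant $C>0$ such that for every $x\in S$ with $\kappa(f,x)<\infty$ and every $y\in\mathbb R$ with $\operatorname{dist}(y,x)<1/(C\mu(f,x))$ one has $y\in S$ and $\mu(f,y)\le C\mu(f,x)$. Let $$H(f,x)=\frac{x^2f(x)f''(x)}{f(x)^2+x^2f'(x)^2}$$ (where the denominator is nonzero). Each of the following functions $f$ is amenable on the stated domain $S$. For every $x\in S$, $\kappa(f,x)$ is given by the stated formula, with the convention that $\kappa(f,x)=0$ if $x=0$ and $\kappa(f,x)=\infty$ if $x\ne0$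 and $f(x)=0$. Moreover $|H(f,x)|\le B$ at every $x\in S$ where $H(f,x)$ is defined, with the stated constant $B$. In (1)-(3) the claim about $B$ is that some finite $B$, depending on $f$, exists, and the formula for $\kappa$ is claimed when $f$ is not identically zero. 1. $f=p$ any real polynomial; $S=\mathbb R$; $\kappa=|xp'(x)/p(x)|$. 2. $f=p/q$ any real rational function in lowest terms; $S=\{x\in\mathbb R:q(x)\neq0\}$; $\kappa=|xf'(x)/f(x)|$. 3. $f(x)=\sum_{i=1}^k a_ix^{\alpha_i}$ with $k\ge 0$ an integer and $a_i,\alpha_i\in\mathbb R$; $S=(0,\infty)$; $\kappa=|xf'(x)/f(x)|$. 4. $f=\sin$; $S=(k_1\pi,k_2\pi)$ with integers $k_1\le k_2$; $\kappa=|x\cos x/\sin x|$; $B=u^2\pi^2$, $u=\max(|k_1|,|k_2|)$. 5. $f=\cos$; $S=(k_1\pi-\frac\pi2,k_2\pi+\frac\pi2)$ with integers $k_1\le k_2$; $\kappa=|x\sin x/\cos x|$; $B=(1+u^2)\pi^2$, $u=\max(|k_1|,|k_2|)$. 6. $f=\tan$; $S=\bigcup_{k\in K}(k\pi-\frac\pi2,k\pi+\frac\pi2)$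 with $K\subset\mathbb Z$ finite; $\kappa=|2x/\sin(2x)|$; $B=2$. 7. $f=1/\sin$; $S=(k\pi,k\pi+\pi)$, $k\in\mathbb Z$; $\kappa=|x\cos x/\sin x|$; $B=3(1+|k|)^2\pi^2$. 8. $f=1/\cos$; $S=(k\pi-\frac\pi2,k\pi+\frac\pi2)$, $k\in\mathbb Z$; $\kappa=|x\sin x/\cos x|$; $B=3(\frac12+|k|)^2\pi^2$. 9. $f=\cot$; $S=\bigcup_{k\in K}(k\pi,k\pi+\pi)$ with $K\subset\mathbb Z$ finite; $\kappa=|2x/\sin(2x)|$; $B=2$. 10. $f(x)=e^x$; $S=\mathbb R$; $\kappa=|x|$; $B=1$. 11. $f=\log$; $S=(0,\infty)$; $\kappa=|1/\log x|$; $B=1$. 12. $f=\sinh$; $S=\mathbb R$; $\kappa=|x\cosh x/\sinh x|$; $B=1$. 13. $f=\cosh$; $S=\mathbb R$; $\kappa=|x\sinh x/\cosh x|$; $B=1$. 14. $f=\operatorname{atan}$; $S=\mathbb R$; $\kappa=\left|\frac{x/(x^2+1)}{\operatorname{atan}x}\right|$; $B=1$. 15. $f=\operatorname{asinh}$; $S=\mathbb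 R$; $\kappa=\left|\frac{x/\sqrt{x^2+1}}{\operatorname{asinh}x}\right|$; $B=1$. 16. $f=\operatorname{acosh}$; $S=(1,\infty)$; $\kappa=\left|\frac{x/\sqrt{x^2-1}}{\operatorname{acosh}x}\right|$; $B=2$. 17. $f=\Gamma$; $S=(0,\infty)$; $\kappa=|x\psi(x)|$; $B=3$. 18. $f=\psi=\Gamma'/\Gamma$ (digamma); $S=(0,\infty)$; $\kappa=|x\psi'(x)/\psi(x)|$; $B=1$. 19. $f(x)=\sin(\log x)$; $S=(0,\infty)$; $\kappa=|\cos(\log x)/\sin(\log x)|$; $B=\frac{1+\sqrt2}2$. -/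

import Mathlib

open Set
open scoped ENNReal

noncomputable section

/-- The relative error distance on `ℝ`: `0` between `0` and itself, `|log (y / x)|` between two
nonzero numbers of the same sign, and `∞` otherwise. -/
def relDist (x y : ℝ) : ℝ≥0∞ :=
  if x = 0 ∧ y = 0 then 0
  else if 0 < x * y then ENNReal.ofReal |Real.log (y / x)|
  else ⊤

/-- The condition number `κ(f, x)` of `f : S → ℝ` at `x`, i.e. the limit as `ε → 0⁺` of the supremum
of `relDist (f x) (f y) / relDist x y` over `y ∈ S` with `relDist x y ≤ ε`. The supremum is monotone
in `ε`, so the limit is the infimum over `ε > 0`. In `ℝ≥0∞` we have `0 / 0 = 0`, so that `y = x`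
does not contribute. -/
def condNumber (f : ℝ → ℝ) (S : Set ℝ) (x : ℝ) : ℝ≥0∞ :=
  ⨅ (ε : ℝ) (_ : 0 < ε), ⨆ (y : ℝ) (_ : y ∈ S) (_ : relDist x y ≤ ENNReal.ofReal ε),
    relDist (f x) (f y) / relDist x y

/-- `μ(f, x) = 1 + κ(f, x)`. -/
def muNumber (f : ℝ → ℝ) (S : Set ℝ) (x : ℝ) : ℝ≥0∞ :=
  1 + condNumber f S x

/-- `f : S → ℝ` is amenable: there is `C > 0` such that for every `x ∈ S` with `κ(f, x) < ∞`, each `y`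
at relative distance less than `1 / (C * μ(f, x))` from `x` lies in `S` and satisfies
`μ(f, y) ≤ C * μ(f, x)`. -/
def Amenable (f : ℝ → ℝ) (S : Set ℝ) : Prop :=
  ∃ C : ℝ, 0 < C ∧ ∀ x ∈ S, condNumber f S x < ⊤ →
    ∀ y : ℝ, relDist y x < 1 / (ENNReal.ofReal C * muNumber f S x) →
      y ∈ S ∧ muNumber f S y ≤ ENNReal.ofReal C * muNumber f S x

/-- `H(f, x) = x² f(x) f''(x) / (f(x)² + x² f'(x)²)`. Where the denominator vanishes the value is
Lean's `0`, so an upper bound on `|H|` says nothing at such points. -/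
def hQuot (f : ℝ → ℝ) (x : ℝ) : ℝ :=
  x ^ 2 * f x * deriv (deriv f) x / (f x ^ 2 + x ^ 2 * deriv f x ^ 2)

/-- On `S` the condition number of `f` is given by the formula `|k x|`, with the usual reading at
the exceptional points: it is `0` at `x = 0` and `∞` at a nonzero zero of `f`. -/
def CondFormula (f : ℝ → ℝ) (S : Set ℝ) (k : ℝ → ℝ) : Prop :=
  ∀ x ∈ S, condNumber f S x =
    if x = 0 then 0 else if f x = 0 then ⊤ else ENNReal.ofReal |k x|

/-- `f` is amenable on `S`, its condition number is given by `|k x|`, and `|H(f, x)| ≤ B` on `S`. -/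
def AmenableWith (f : ℝ → ℝ) (S : Set ℝ) (k : ℝ → ℝ) (B : ℝ) : Prop :=
  Amenable f S ∧ CondFormula f S k ∧ ∀ x ∈ S, |hQuot f x| ≤ B

/-- The digamma function on the reals, `ψ = Γ' / Γ`. -/
def realDigamma : ℝ → ℝ := logDeriv Real.Gamma

end

/-!
In the coordinate `t = log |x|` and with `L = log |f|`, the condition number of `f` is `|θ|`, where
`θ = dL/dt = x f' / f` (`condNumber_of_hasDerivAt`), and the quotient `H` is tailored to the identity
`dθ/dt = θ - θ² + H (1 + θ²)`. If `|H| ≤ B`, it follows that `arctan θ` is Lipschitz in `t` with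
constant `B + 2`, and so is `1 / √(1 + θ²) = cos (arctan θ)`. This is comparable to `1 / μ`, hence
over a distance small compared with `1 / μ` the number `μ` grows by at most a constant factor. Along
such a path `L` stays bounded, so that the path can reach neither a zero of `f` nor a boundary point of
the domain where `|L| → ∞`. Thus a twice differentiable function with bounded `H`, not vanishing on
any open set, is amenable as soon as `|L|` blows up at the nonzero boundary points of its domain
(`amenable_of_hQuot_le`), and the main task for each of the functions is to bound `H`.

For rational functions and sums of real powers the bound is qualitative. Near a zero or pole of order
`n ≠ 0`, possibly the origin, `f` is `O((x - a) f')` and `(x - a) f''` is `O(f')`; elsewhere `f''` is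
`O(f)`; so `H` is locally bounded (`MeromorphicAt.exists_abs_hQuot_le`). At the ends of the domain
`x² f'' = O(f)`, which suffices as well, and compactness does the rest.

For the special functions `H` is estimated explicitly. Several cases, the digamma function among them,
reduce to `|x f''| ≤ 2 |f'|`, which gives `|H| ≤ 1` by the inequality of the arithmetic and geometric
means (`abs_le_of_abs_mul_le_two_mul`). For the digamma function this is a termwise comparison of the
series `ψ' = ∑ 1 / (x + m)²` and `ψ'' = -∑ 2 / (x + m)³`. These are obtained from the functional
equation of `ψ` and its monotonicity, that is, the convexity of `log Γ`. The bound for `Γ` uses in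
addition `x² ψ' ≤ x + 1` and `ψ(2) = 1 - γ > 1/3`.
-/

open Filter Topology

/-! ### The relative distance and the condition number -/

lemma relDist_self (x : ℝ) : relDist x x = 0 := by
  unfold relDist
  by_cases hx : x = 0
  · simp [hx]
  · have : 0 < x * x := mul_self_pos.2 hx
    simp [hx]

lemma relDist_of_mul_pos {x y : ℝ} (h : 0 < x * y) :
    relDist x y = ENNReal.ofReal |Real.log (y / x)| := by
  have hx : x ≠ 0 := by rintro rfl; simp at h
  simp [relDist, hx, h]

lemma relDist_lt_top {x y : ℝ} (h : relDist x y < ⊤) : (x = 0 ∧ y = 0) ∨ 0 < x * y := by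
  unfold relDist at h
  split_ifs at h with h1 h2
  · exact Or.inl h1
  · exact Or.inr h2
  · simp at h

lemma relDist_eq_top {x y : ℝ} (h : x * y ≤ 0) (h' : ¬(x = 0 ∧ y = 0)) : relDist x y = ⊤ := by
  simp [relDist, h', not_lt.2 h]

/-- Points at a finite relative distance from `x ≠ 0` are the `x * exp t`, and `|t|` is the
distance. -/
lemma exists_eq_mul_exp {x y : ℝ} (h : 0 < x * y) :
    y = x * Real.exp (Real.log (y / x)) := by
  have hx : x ≠ 0 := by rintro rfl; simp at h
  have hy : y ≠ 0 := by rintro rfl; simp at h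
  have : 0 < y / x := by
    rw [show y / x = x * y / (x * x) by field_simp]
    exact div_pos h (mul_self_pos.2 hx)
  rw [Real.exp_log this]
  field_simp

lemma eventually_relDist_le {x : ℝ} (hx : x ≠ 0) {ε : ℝ} (hε : 0 < ε) :
    ∀ᶠ y in 𝓝 x, relDist x y ≤ ENNReal.ofReal ε := by
  have h1 : Tendsto (fun y => Real.log (y / x)) (𝓝 x) (𝓝 0) := by
    have : ContinuousAt (fun y => Real.log (y / x)) x :=
      ContinuousAt.log (by fun_prop) (by simp [hx])
    simpa [ContinuousAt, hx] using this
  have h2 : ∀ᶠ y in 𝓝 x, 0 < x * y :=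
    (by fun_prop : ContinuousAt (fun y => x * y) x).eventually
      (lt_mem_nhds (mul_self_pos.2 hx))
  filter_upwards [h1.eventually (Metric.ball_mem_nhds 0 hε), h2] with y hy h
  rw [relDist_of_mul_pos h]
  apply ENNReal.ofReal_le_ofReal
  simpa using (le_of_lt hy : dist (Real.log (y / x)) 0 ≤ ε)

lemma exists_relDist_le_imp {x : ℝ} (hx : x ≠ 0) {p : ℝ → Prop} (hp : ∀ᶠ y in 𝓝 x, p y) :
    ∃ ε : ℝ, 0 < ε ∧ ∀ y, relDist x y ≤ ENNReal.ofReal ε → p y := by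
  have h1 : Tendsto (fun t : ℝ => x * Real.exp t) (𝓝 0) (𝓝 x) := by
    have : ContinuousAt (fun t : ℝ => x * Real.exp t) 0 := by fun_prop
    simpa [ContinuousAt] using this
  obtain ⟨ε, hε, h⟩ := Metric.eventually_nhds_iff.1 (h1.eventually hp)
  refine ⟨ε / 2, by positivity, fun y hy => ?_⟩
  rcases relDist_lt_top (hy.trans_lt ENNReal.ofReal_lt_top) with h0 | h0
  · exact absurd h0.1 hx
  rw [relDist_of_mul_pos h0, ENNReal.ofReal_le_ofReal_iff (by positivity)] at hy
  rw [exists_eq_mul_exp h0]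
  apply h
  rw [dist_zero_right, Real.norm_eq_abs]
  linarith

lemma condNumber_zero (f : ℝ → ℝ) (S : Set ℝ) : condNumber f S 0 = 0 := by
  refine le_antisymm ?_ bot_le
  refine (iInf₂_le 1 one_pos).trans ?_
  refine iSup₂_le fun y _ => iSup_le fun hy => ?_
  rcases relDist_lt_top (hy.trans_lt ENNReal.ofReal_lt_top) with h0 | h0
  · simp [h0.2, relDist_self]
  · simp at h0

lemma condNumber_of_eq_zero {f : ℝ → ℝ} {S : Set ℝ} (hf : ∀ x ∈ S, f x = 0) {x : ℝ} (hx : x ∈ S) :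
    condNumber f S x = 0 := by
  refine le_antisymm ?_ bot_le
  refine (iInf₂_le 1 one_pos).trans ?_
  refine iSup₂_le fun y hy => iSup_le fun _ => ?_
  simp [hf x hx, hf y hy, relDist_self]

/-- At a zero `x ≠ 0` of `f` the condition number is infinite, unless `f` vanishes near `x`. -/
lemma condNumber_eq_top {f : ℝ → ℝ} {S : Set ℝ} {x : ℝ} (hx : x ≠ 0) (hfx : f x = 0)
    (h : ∃ᶠ y in 𝓝 x, y ∈ S ∧ f y ≠ 0) : condNumber f S x = ⊤ := by
  refine eq_top_iff.2 (le_iInf₂ fun ε hε => ?_)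
  obtain ⟨y, ⟨hyS, hfy⟩, hy⟩ := (h.and_eventually (eventually_relDist_le hx hε)).exists
  refine le_trans ?_ (le_iSup₂_of_le y hyS (le_iSup_of_le hy le_rfl))
  rw [relDist_eq_top (x := f x) (by simp [hfx]) (by simp [hfy]),
    ENNReal.top_div_of_lt_top (hy.trans_lt ENNReal.ofReal_lt_top)]

/-- In the coordinates `log |x|`, `log |f x|` the condition number is the absolute value of a
derivative. -/
lemma condNumber_of_hasDerivAt {f : ℝ → ℝ} {S : Set ℝ} {x f' : ℝ} (hx : x ≠ 0) (hfx : f x ≠ 0)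
    (hS : S ∈ 𝓝 x) (hf : HasDerivAt f f' x) :
    condNumber f S x = ENNReal.ofReal |x * f' / f x| := by
  have hlim : Tendsto (fun y => relDist (f x) (f y) / relDist x y) (𝓝[≠] x)
      (𝓝 (ENNReal.ofReal |x * f' / f x|)) := by
    have h1 := (hasDerivAt_iff_tendsto_slope.1 (hf.log hfx)).div
      (hasDerivAt_iff_tendsto_slope.1 (Real.hasDerivAt_log hx)) (inv_ne_zero hx)
    rw [show f' / f x / x⁻¹ = x * f' / f x by field_simp] at h1
    refine ((ENNReal.continuous_ofReal.tendsto _).comp h1.abs).congr' ?_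
    have h2 : ∀ᶠ y in 𝓝 x, 0 < x * y :=
      (by fun_prop : ContinuousAt (fun y => x * y) x).eventually
        (lt_mem_nhds (mul_self_pos.2 hx))
    have h3 : ∀ᶠ y in 𝓝 x, 0 < f x * f y :=
      (continuousAt_const.mul hf.continuousAt).eventually (lt_mem_nhds (mul_self_pos.2 hfx))
    filter_upwards [nhdsWithin_le_nhds h2, nhdsWithin_le_nhds h3, self_mem_nhdsWithin]
      with y hy2 hy3 hne
    have hy : y ≠ 0 := by rintro rfl; simp at hy2
    have hfy : f y ≠ 0 := by intro h; simp [h] at hy3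
    have hyx : y - x ≠ 0 := sub_ne_zero.2 hne
    have hlog : Real.log y - Real.log x ≠ 0 := by
      rw [← Real.log_div hy hx]
      intro h0
      have := exists_eq_mul_exp hy2
      rw [h0, Real.exp_zero, mul_one] at this
      exact hne this
    rw [relDist_of_mul_pos hy2, relDist_of_mul_pos hy3,
      Real.log_div hy hx, Real.log_div hfy hfx, ← ENNReal.ofReal_div_of_pos (abs_pos.2 hlog),
      ← abs_div]
    simp only [Function.comp_apply, slope_def_field, Pi.div_apply]
    congr 2
    field_simp
  apply le_antisymm
  · refine le_of_forall_gt fun c hc => ?_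
    obtain ⟨c', hc', hcc⟩ := exists_between hc
    have hev : ∀ᶠ y in 𝓝 x, relDist (f x) (f y) / relDist x y ≤ c' := by
      have := eventually_nhdsWithin_iff.1 (hlim.eventually (gt_mem_nhds hc'))
      filter_upwards [this] with y hy
      by_cases h : y = x
      · simp [h, relDist_self]
      · exact (hy h).le
    obtain ⟨ε, hε, h⟩ := exists_relDist_le_imp hx hev
    refine lt_of_le_of_lt ((iInf₂_le ε hε).trans ?_) hcc
    exact iSup₂_le fun y _ => iSup_le fun hy => h y hy
  · refine le_iInf₂ fun ε hε => le_of_tendsto hlim ?_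
    filter_upwards [nhdsWithin_le_nhds hS, nhdsWithin_le_nhds (eventually_relDist_le hx hε)]
      with y hyS hy
    exact le_iSup₂_of_le y hyS (le_iSup_of_le hy le_rfl)

lemma condFormula_of_differentiable {f : ℝ → ℝ} {S : Set ℝ} {k : ℝ → ℝ} (hS : IsOpen S)
    (hf : ∀ x ∈ S, DifferentiableAt ℝ f x)
    (hk : ∀ x ∈ S, x ≠ 0 → f x ≠ 0 → |k x| = |x * deriv f x / f x|)
    (hz : ∀ x ∈ S, x ≠ 0 → f x = 0 → ∃ᶠ y in 𝓝 x, f y ≠ 0) :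
    CondFormula f S k := by
  intro x hx
  split_ifs with h0 h1
  · rw [h0, condNumber_zero]
  · exact condNumber_eq_top h0 h1
      (((hz x hx h0 h1).and_eventually (hS.mem_nhds hx)).mono fun y hy => hy.symm)
  · rw [condNumber_of_hasDerivAt h0 h1 (hS.mem_nhds hx) (hf x hx).hasDerivAt, hk x hx h0 h1]

/-- A function vanishing on a domain that is a union of half-lines `(-∞, 0)`, `(0, ∞)` and the
origin is amenable, because its condition number is zero. -/
lemma amenable_of_eq_zero {f : ℝ → ℝ} {S : Set ℝ} (hf : ∀ x ∈ S, f x = 0)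
    (hS : ∀ x ∈ S, ∀ y, 0 < y * x → y ∈ S) : Amenable f S := by
  refine ⟨1, one_pos, fun x hx _ y hy => ?_⟩
  simp only [muNumber, condNumber_of_eq_zero hf hx] at hy ⊢
  have hyS : y ∈ S := by
    rcases relDist_lt_top (hy.trans_le le_top) with h | h
    · rwa [h.1, ← h.2]
    · exact hS x hx y h
  refine ⟨hyS, ?_⟩
  simp [condNumber_of_eq_zero hf hyS]

/-! ### Bounded `H` implies amenability -/

/-- Derivative of `arctan (x f' / f)` along the flow `t ↦ z * exp (a * t)`. By definition of `H`, the
logarithmic derivative `θ = x f' / f` satisfies `dθ/dt = θ - θ² + H * (1 + θ²)` in the coordinate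
`t = log |x|`, so that `arctan θ` is Lipschitz as soon as `H` is bounded. -/
lemma hasDerivAt_arctan_theta {f : ℝ → ℝ} {B : ℝ} {x a τ : ℝ}
    (hx : x * Real.exp (a * τ) ≠ 0) (hf0 : f (x * Real.exp (a * τ)) ≠ 0)
    (hf : DifferentiableAt ℝ f (x * Real.exp (a * τ)))
    (hf2 : DifferentiableAt ℝ (deriv f) (x * Real.exp (a * τ)))
    (hH : |hQuot f (x * Real.exp (a * τ))| ≤ B) :
    ∃ d, |d| ≤ |a| * (B + 2) ∧
      HasDerivAt (fun t =>
        Real.arctan ((fun z => z * deriv f z / f z) (x * Real.exp (a * t)))) d τ := by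
  have hγ : HasDerivAt (fun t => x * Real.exp (a * t)) (a * (x * Real.exp (a * τ))) τ := by
    have := (((hasDerivAt_id τ).const_mul a).exp).const_mul x
    refine this.congr_deriv ?_
    simp only [id]
    ring
  set z := x * Real.exp (a * τ) with hz
  have hθ : HasDerivAt (fun z => z * deriv f z / f z)
      (((1 * deriv f z + z * deriv (deriv f) z) * f z - z * deriv f z * deriv f z) / f z ^ 2) z :=
    ((hasDerivAt_id z).mul hf2.hasDerivAt).div hf.hasDerivAt hf0
  refine ⟨_, ?_, (HasDerivAt.comp (h₂ := fun z => z * deriv f z / f z) τ hθ hγ).arctan⟩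
  simp only [Function.comp_def, ← hz]
  set θ := z * deriv f z / f z with hθ'
  have h1 : 0 < 1 + θ ^ 2 := by positivity
  have hD : 0 < f z ^ 2 + z ^ 2 * deriv f z ^ 2 := by positivity
  have key : ((1 * deriv f z + z * deriv (deriv f) z) * f z - z * deriv f z * deriv f z) / f z ^ 2 * z
      = θ - θ ^ 2 + hQuot f z * (1 + θ ^ 2) := by
    have : 1 + θ ^ 2 = (f z ^ 2 + z ^ 2 * deriv f z ^ 2) / f z ^ 2 := by
      rw [hθ']; field_simp
    rw [this, hθ', hQuot]
    field_simp
    ring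
  have hB : |θ - θ ^ 2 + hQuot f z * (1 + θ ^ 2)| ≤ (B + 2) * (1 + θ ^ 2) := by
    have h2 : |hQuot f z * (1 + θ ^ 2)| ≤ B * (1 + θ ^ 2) := by
      rw [abs_mul, abs_of_pos h1]
      exact mul_le_mul_of_nonneg_right hH h1.le
    have h3 : |θ - θ ^ 2| ≤ 2 * (1 + θ ^ 2) := by
      rw [abs_le]; constructor <;> nlinarith [sq_nonneg (θ - 1), sq_nonneg (θ + 1)]
    linarith [abs_add_le (θ - θ ^ 2) (hQuot f z * (1 + θ ^ 2))]
  rw [show ∀ A : ℝ, 1 / (1 + θ ^ 2) * (A * (a * z)) = a * ((A * z) / (1 + θ ^ 2)) by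
    intro A; ring, key, abs_mul, abs_div, abs_of_pos h1]
  exact mul_le_mul_of_nonneg_left ((div_le_iff₀ h1).2 hB) (abs_nonneg a)

lemma abs_inv_sqrt_sub_le (s t : ℝ) :
    |1 / √(1 + s ^ 2) - 1 / √(1 + t ^ 2)| ≤ |Real.arctan s - Real.arctan t| := by
  rw [← Real.cos_arctan, ← Real.cos_arctan]
  exact Real.abs_cos_sub_cos_le _ _

/-- The part of the domain where the condition number is finite, apart from the origin. -/
def regularSet (f : ℝ → ℝ) (S : Set ℝ) : Set ℝ := {x | x ∈ S ∧ x ≠ 0 ∧ f x ≠ 0}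

section Continuation

variable {f : ℝ → ℝ} {S : Set ℝ} {B : ℝ} {x a : ℝ}

/-- A priori estimates along a path which stays in the regular set: over a time `b ≤ 1` the
quantity `√(1 + θ²)` at most doubles, and therefore `log |f|` changes by a bounded amount. -/
lemma theta_le_and_log_le_of_path (hf : ∀ z ∈ S, DifferentiableAt ℝ f z)
    (hf2 : ∀ z ∈ S, DifferentiableAt ℝ (deriv f) z) (hH : ∀ z ∈ S, |hQuot f z| ≤ B)
    (ha : |a| * (B + 2) ≤ 1 / (2 * √(1 + (x * deriv f x / f x) ^ 2))) {b : ℝ} (hb : 0 ≤ b)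
    (hb1 : b ≤ 1) (hU : ∀ τ ∈ Icc 0 b, x * Real.exp (a * τ) ∈ regularSet f S) :
    √(1 + (x * Real.exp (a * b) * deriv f (x * Real.exp (a * b)) / f (x * Real.exp (a * b))) ^ 2)
        ≤ 2 * √(1 + (x * deriv f x / f x) ^ 2) ∧
      |Real.log (f (x * Real.exp (a * b))) - Real.log (f x)|
        ≤ |a| * (2 * √(1 + (x * deriv f x / f x) ^ 2)) := by
  set θ : ℝ → ℝ := fun z => z * deriv f z / f z with hθ
  set r := √(1 + (θ x) ^ 2) with hr
  have hr0 : 0 < r := by positivity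
  have hd : ∀ τ ∈ Icc 0 b, ∃ d, |d| ≤ |a| * (B + 2) ∧
      HasDerivAt (fun t => Real.arctan (θ (x * Real.exp (a * t)))) d τ := fun τ hτ =>
    hasDerivAt_arctan_theta (hU τ hτ).2.1 (hU τ hτ).2.2 (hf _ (hU τ hτ).1) (hf2 _ (hU τ hτ).1)
      (hH _ (hU τ hτ).1)
  have hr2 : ∀ c ∈ Icc 0 b, √(1 + (θ (x * Real.exp (a * c))) ^ 2) ≤ 2 * r := by
    intro c hc
    choose! d hd1 hd2 using hd
    have hsub : Icc 0 c ⊆ Icc 0 b := Icc_subset_Icc_right hc.2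
    have h1 := norm_image_sub_le_of_norm_deriv_le_segment'
      (fun τ hτ => (hd2 τ (hsub hτ)).hasDerivWithinAt)
      (fun τ hτ => hd1 τ (hsub (Ico_subset_Icc_self hτ))) c (right_mem_Icc.2 hc.1)
    simp only [mul_zero, Real.exp_zero, mul_one, sub_zero, Real.norm_eq_abs] at h1
    have hB0 : 0 ≤ |a| * (B + 2) := le_trans (abs_nonneg _) (hd1 0 ⟨le_rfl, hb⟩)
    have h2 : |a| * (B + 2) * c ≤ 1 / (2 * r) :=
      (mul_le_of_le_one_right hB0 (hc.2.trans hb1)).trans ha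
    have h3 := abs_le.1 ((abs_inv_sqrt_sub_le _ _).trans (h1.trans h2))
    have h4 : 1 / (2 * r) ≤ 1 / √(1 + (θ (x * Real.exp (a * c))) ^ 2) := by
      have : 1 / √(1 + θ x ^ 2) = 1 / (2 * r) + 1 / (2 * r) := by rw [← hr]; field_simp; norm_num
      linarith [h3.1]
    exact (one_div_le_one_div (by positivity) (by positivity)).1 h4
  refine ⟨hr2 b ⟨hb, le_rfl⟩, ?_⟩
  have h1 := norm_image_sub_le_of_norm_deriv_le_segment' (a := 0) (b := b)
    (f := fun t => Real.log (f (x * Real.exp (a * t))))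
    (f' := fun t => a * θ (x * Real.exp (a * t))) (C := |a| * (2 * r))
    (fun τ hτ => by
      have hγ : HasDerivAt (fun t => x * Real.exp (a * t)) (a * (x * Real.exp (a * τ))) τ := by
        have := (((hasDerivAt_id τ).const_mul a).exp).const_mul x
        refine this.congr_deriv ?_
        simp only [id]
        ring
      have h := (((hf _ (hU τ hτ).1).hasDerivAt).comp τ hγ).log (hU τ hτ).2.2
      refine (h.congr_deriv ?_).hasDerivWithinAt
      simp only [hθ, Function.comp_def]
      ring)
    (fun τ hτ => by
      rw [Real.norm_eq_abs, abs_mul]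
      refine mul_le_mul_of_nonneg_left (le_trans ?_ (hr2 τ (Ico_subset_Icc_self hτ)))
        (abs_nonneg a)
      exact Real.abs_le_sqrt (by linarith))
    b (right_mem_Icc.2 hb)
  simp only [mul_zero, Real.exp_zero, mul_one, sub_zero, Real.norm_eq_abs] at h1
  exact h1.trans (mul_le_of_le_one_right (by positivity) hb1)

lemma isOpen_regularSet (hS : IsOpen S) (hf : ∀ z ∈ S, DifferentiableAt ℝ f z) :
    IsOpen (regularSet f S) := by
  rw [isOpen_iff_mem_nhds]
  rintro z ⟨h1, h2, h3⟩
  filter_upwards [hS.mem_nhds h1, isOpen_ne.mem_nhds h2,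
    (hf z h1).continuousAt.eventually_ne h3] with y a b c using ⟨a, b, c⟩

/-- A short path starting in the regular set stays there: where it first left, `|log |f||` would be
unbounded, contrary to the a priori estimate. -/
lemma path_mem_regularSet (hS : IsOpen S) (hf : ∀ z ∈ S, DifferentiableAt ℝ f z)
    (hf2 : ∀ z ∈ S, DifferentiableAt ℝ (deriv f) z) (hH : ∀ z ∈ S, |hQuot f z| ≤ B)
    (hbd : ∀ s ∈ closure S, s ∉ S → s ≠ 0 → Tendsto (fun z => |Real.log (f z)|) (𝓝[S] s) atTop)
    (hx : x ∈ regularSet f S)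
    (ha : |a| * (B + 2) ≤ 1 / (2 * √(1 + (x * deriv f x / f x) ^ 2))) :
    ∀ τ ∈ Icc (0 : ℝ) 1, x * Real.exp (a * τ) ∈ regularSet f S := by
  by_contra! hcon
  obtain ⟨τ₀, hτ₀, hbad⟩ := hcon
  have hγ : Continuous fun τ => x * Real.exp (a * τ) := by fun_prop
  have hcomp : IsCompact (Icc (0 : ℝ) 1 ∩ (fun τ => x * Real.exp (a * τ)) ⁻¹' (regularSet f S)ᶜ) :=
    isCompact_Icc.inter_right ((isOpen_regularSet hS hf).isClosed_compl.preimage hγ)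
  obtain ⟨b, ⟨⟨hb0, hb1⟩, hbU⟩, hmin⟩ := hcomp.exists_isLeast ⟨τ₀, hτ₀, hbad⟩
  have hbpos : 0 < b := by
    rcases hb0.eq_or_lt with h | h
    · exact absurd hx (by simpa [← h] using hbU)
    · exact h
  have hlt : ∀ τ, 0 ≤ τ → τ < b → x * Real.exp (a * τ) ∈ regularSet f S := by
    intro τ h0 hτ
    by_contra h
    exact absurd (hmin ⟨⟨h0, hτ.le.trans hb1⟩, h⟩) (not_le.2 hτ)
  have hnear : ∀ᶠ τ in 𝓝[<] b, 0 < τ ∧ τ < b := by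
    filter_upwards [Ioo_mem_nhdsLT hbpos] with τ hτ using hτ
  set s := x * Real.exp (a * b) with hs
  have hs0 : s ≠ 0 := mul_ne_zero hx.2.1 (Real.exp_ne_zero _)
  have hγb : Tendsto (fun τ => x * Real.exp (a * τ)) (𝓝[<] b) (𝓝[regularSet f S] s) := by
    refine tendsto_nhdsWithin_iff.2 ⟨(hγ.tendsto b).mono_left nhdsWithin_le_nhds, ?_⟩
    filter_upwards [hnear] with τ hτ using hlt τ hτ.1.le hτ.2
  have hU : Tendsto (fun z => |Real.log (f z)|) (𝓝[regularSet f S] s) atTop := by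
    by_cases hsS : s ∈ S
    · have hfs : f s = 0 := by
        by_contra h
        exact hbU ⟨hsS, hs0, h⟩
      have h1 : Tendsto f (𝓝[regularSet f S] s) (𝓝[≠] 0) := by
        refine tendsto_nhdsWithin_iff.2 ⟨?_, ?_⟩
        · have := (hf s hsS).continuousAt.tendsto
          rw [hfs] at this
          exact this.mono_left nhdsWithin_le_nhds
        · filter_upwards [self_mem_nhdsWithin] with z hz using hz.2.2
      exact tendsto_abs_atBot_atTop.comp (Real.tendsto_log_nhdsNE_zero.comp h1)
    · have hmono : 𝓝[regularSet f S] s ≤ 𝓝[S] s := nhdsWithin_mono _ fun z hz => hz.1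
      have hne : (𝓝[S] s).NeBot := (hγb.mono_right hmono).neBot
      exact (hbd s (mem_closure_iff_nhdsWithin_neBot.2 hne) hsS hs0).mono_left hmono
  have hT := (hU.comp hγb).eventually_gt_atTop
    (|Real.log (f x)| + |a| * (2 * √(1 + (x * deriv f x / f x) ^ 2)))
  obtain ⟨τ, hτ, h0, hτb⟩ := (hT.and hnear).exists
  have h := (theta_le_and_log_le_of_path hf hf2 hH ha h0.le (hτb.le.trans hb1)
    fun t ht => hlt t ht.1 (ht.2.trans_lt hτb)).2
  have h' := abs_sub_abs_le_abs_sub (Real.log (f (x * Real.exp (a * τ)))) (Real.log (f x))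
  simp only [Function.comp_apply] at hτ
  linarith

end Continuation

/-- A twice differentiable function with bounded `H` is amenable, provided that `|log |f||` blows up
at the nonzero boundary points of its domain. The formula for the condition number serves to exclude
functions that vanish near a point, where the condition number is finite at a zero. -/
theorem amenable_of_hQuot_le {f : ℝ → ℝ} {S : Set ℝ} {k : ℝ → ℝ} {B : ℝ} (hS : IsOpen S)
    (hf : ∀ x ∈ S, DifferentiableAt ℝ f x) (hf2 : ∀ x ∈ S, DifferentiableAt ℝ (deriv f) x)
    (hκ : CondFormula f S k)
    (hbd : ∀ s ∈ closure S, s ∉ S → s ≠ 0 → Tendsto (fun z => |Real.log (f z)|) (𝓝[S] s) atTop)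
    (hH : ∀ x ∈ S, |hQuot f x| ≤ B) : Amenable f S := by
  rcases S.eq_empty_or_nonempty with rfl | ⟨x₀, hx₀⟩
  · exact ⟨1, one_pos, by simp⟩
  have hB : 0 ≤ B := (abs_nonneg _).trans (hH x₀ hx₀)
  refine ⟨2 * B + 4, by linarith, fun x hx hfin y hy => ?_⟩
  have hCμ : ENNReal.ofReal 1 ≤ ENNReal.ofReal (2 * B + 4) :=
    ENNReal.ofReal_le_ofReal (by linarith)
  rw [ENNReal.ofReal_one] at hCμ
  rcases relDist_lt_top (hy.trans_le le_top) with ⟨rfl, rfl⟩ | hxy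
  · exact ⟨hx, le_mul_of_one_le_left bot_le hCμ⟩
  have hx0 : x ≠ 0 := by rintro rfl; simp at hxy
  have hfx : f x ≠ 0 := by
    intro h
    have := hκ x hx
    rw [if_neg hx0, if_pos h] at this
    exact hfin.ne this
  set θ : ℝ → ℝ := fun z => z * deriv f z / f z with hθ
  have hμ : ∀ z ∈ regularSet f S, muNumber f S z = ENNReal.ofReal (1 + |θ z|) := by
    intro z hz
    rw [muNumber, condNumber_of_hasDerivAt hz.2.1 hz.2.2 (hS.mem_nhds hz.1)
      (hf z hz.1).hasDerivAt, ENNReal.ofReal_add zero_le_one (abs_nonneg _), ENNReal.ofReal_one]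
  have hxU : x ∈ regularSet f S := ⟨hx, hx0, hfx⟩
  rw [mul_comm] at hxy
  set a := Real.log (y / x) with ha
  have hya : y = x * Real.exp (a * 1) := by rw [mul_one]; exact exists_eq_mul_exp hxy
  have hdist : |a| < 1 / ((2 * B + 4) * (1 + |θ x|)) := by
    rw [relDist_of_mul_pos (by linarith), hμ x hxU, ← ENNReal.ofReal_mul (by linarith),
      ← ENNReal.ofReal_one, ← ENNReal.ofReal_div_of_pos (by positivity),
      ENNReal.ofReal_lt_ofReal_iff (by positivity)] at hy
    rwa [ha, show y / x = (x / y)⁻¹ by rw [inv_div], Real.log_inv, abs_neg]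
  have hle : ∀ z, √(1 + (θ z) ^ 2) ≤ 1 + |θ z| := fun z => by
    rw [Real.sqrt_le_left (by positivity)]
    nlinarith [abs_nonneg (θ z), sq_abs (θ z)]
  have hge : ∀ z, 1 + |θ z| ≤ 2 * √(1 + (θ z) ^ 2) := fun z => by
    have h1 : 1 ≤ √(1 + (θ z) ^ 2) := Real.one_le_sqrt.2 (by nlinarith [sq_nonneg (θ z)])
    have h2 : |θ z| ≤ √(1 + (θ z) ^ 2) := Real.abs_le_sqrt (by linarith)
    linarith
  have hsmall : |a| * (B + 2) ≤ 1 / (2 * √(1 + (θ x) ^ 2)) := by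
    have h1 : |a| * (B + 2) ≤ 1 / ((2 * B + 4) * (1 + |θ x|)) * (B + 2) :=
      mul_le_mul_of_nonneg_right hdist.le (by linarith)
    have h2 : 1 / ((2 * B + 4) * (1 + |θ x|)) * (B + 2) = 1 / (2 * (1 + |θ x|)) := by
      field_simp
      ring
    rw [h2] at h1
    exact h1.trans (one_div_le_one_div_of_le (by positivity) (by linarith [hle x]))
  have hU := path_mem_regularSet hS hf hf2 hH hbd hxU hsmall
  have hyU : y ∈ regularSet f S := by rw [hya]; exact hU 1 ⟨zero_le_one, le_rfl⟩
  refine ⟨hyU.1, ?_⟩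
  rw [hμ y hyU, hμ x hxU, ← ENNReal.ofReal_mul (by linarith)]
  apply ENNReal.ofReal_le_ofReal
  have h := (theta_le_and_log_le_of_path hf hf2 hH hsmall zero_le_one le_rfl hU).1
  rw [← hya] at h
  calc 1 + |θ y| ≤ 2 * √(1 + (θ y) ^ 2) := hge y
    _ ≤ 2 * (2 * √(1 + (θ x) ^ 2)) := by
      simpa only [hθ] using mul_le_mul_of_nonneg_left h zero_le_two
    _ ≤ 4 * (1 + |θ x|) := by linarith [hle x]
    _ ≤ (2 * B + 4) * (1 + |θ x|) :=
      mul_le_mul_of_nonneg_right (by linarith) (by positivity)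

/-- All three claims from the differentiability of `f`, the shape of its logarithmic derivative and
the bound on `H`. -/
theorem amenableWith_of_hQuot_le {f : ℝ → ℝ} {S : Set ℝ} {k : ℝ → ℝ} {B : ℝ} (hS : IsOpen S)
    (hf : ∀ x ∈ S, DifferentiableAt ℝ f x) (hf2 : ∀ x ∈ S, DifferentiableAt ℝ (deriv f) x)
    (hk : ∀ x ∈ S, x ≠ 0 → f x ≠ 0 → |k x| = |x * deriv f x / f x|)
    (hz : ∀ x ∈ S, x ≠ 0 → f x = 0 → ∃ᶠ y in 𝓝 x, f y ≠ 0)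
    (hbd : ∀ s ∈ closure S, s ∉ S → s ≠ 0 → Tendsto (fun z => |Real.log (f z)|) (𝓝[S] s) atTop)
    (hH : ∀ x ∈ S, |hQuot f x| ≤ B) : AmenableWith f S k B :=
  have hκ := condFormula_of_differentiable hS hf hk hz
  ⟨amenable_of_hQuot_le hS hf hf2 hκ hbd hH, hκ, hH⟩

lemma abs_hQuot_le {f : ℝ → ℝ} {x B : ℝ} (hB : 0 ≤ B)
    (h : |x ^ 2 * f x * deriv (deriv f) x| ≤ B * (f x ^ 2 + x ^ 2 * deriv f x ^ 2)) :
    |hQuot f x| ≤ B := by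
  rw [hQuot, abs_div, abs_of_nonneg (by positivity : 0 ≤ f x ^ 2 + x ^ 2 * deriv f x ^ 2)]
  exact div_le_of_le_mul₀ (by positivity) hB h

/-- Variant of `amenableWith_of_hQuot_le` for explicitly given first and second derivatives and
simple zeros. -/
theorem amenableWith_of_hasDerivAt {f f' f'' : ℝ → ℝ} {S : Set ℝ} {k : ℝ → ℝ} {B : ℝ}
    (hS : IsOpen S) (hB : 0 ≤ B)
    (hf : ∀ x ∈ S, HasDerivAt f (f' x) x) (hf' : ∀ x ∈ S, HasDerivAt f' (f'' x) x)
    (hk : ∀ x ∈ S, x ≠ 0 → f x ≠ 0 → |k x| = |x * f' x / f x|)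
    (hz : ∀ x ∈ S, x ≠ 0 → f x = 0 → f' x ≠ 0)
    (hbd : ∀ s ∈ closure S, s ∉ S → s ≠ 0 → Tendsto (fun z => |Real.log (f z)|) (𝓝[S] s) atTop)
    (hH : ∀ x ∈ S, x ≠ 0 → f x ≠ 0 →
      |x ^ 2 * f x * f'' x| ≤ B * (f x ^ 2 + x ^ 2 * f' x ^ 2)) :
    AmenableWith f S k B := by
  have hev : ∀ x ∈ S, deriv f =ᶠ[𝓝 x] f' := fun x hx => by
    filter_upwards [hS.mem_nhds hx] with y hy using (hf y hy).deriv
  have h2 : ∀ x ∈ S, HasDerivAt (deriv f) (f'' x) x := fun x hx =>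
    (hf' x hx).congr_of_eventuallyEq (hev x hx)
  refine amenableWith_of_hQuot_le hS (fun x hx => (hf x hx).differentiableAt)
    (fun x hx => (h2 x hx).differentiableAt) ?_ ?_ hbd ?_
  · intro x hx h0 hfx
    rw [(hf x hx).deriv]
    exact hk x hx h0 hfx
  · intro x hx h0 hfx
    have := (hf x hx).eventually_ne (c := 0) (hz x hx h0 hfx)
    exact this.frequently.filter_mono nhdsWithin_le_nhds
  · intro x hx
    refine abs_hQuot_le hB ?_
    rw [(hf x hx).deriv, (h2 x hx).deriv]
    by_cases h0 : x = 0
    · simp only [h0, ne_eq, OfNat.ofNat_ne_zero, not_false_eq_true, zero_pow, zero_mul, abs_zero]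
      positivity
    by_cases hfx : f x = 0
    · simp only [hfx, mul_zero, zero_mul, abs_zero]
      positivity
    exact hH x hx h0 hfx

/-- By the inequality of the arithmetic and geometric means, `|x f''| ≤ 2 |f'|` gives `|H| ≤ 1`. -/
lemma abs_le_of_abs_mul_le_two_mul {x u v w : ℝ} (h : |x * w| ≤ 2 * |v|) :
    |x ^ 2 * u * w| ≤ 1 * (u ^ 2 + x ^ 2 * v ^ 2) := by
  have h1 : |x ^ 2 * u * w| = |u| * |x| * |x * w| := by
    rw [← abs_mul, ← abs_mul]; congr 1; ring
  have h2 : |u| * |x| * |x * w| ≤ |u| * |x| * (2 * |v|) :=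
    mul_le_mul_of_nonneg_left h (by positivity)
  rw [h1, ← sq_abs u, ← sq_abs x, ← sq_abs v]
  nlinarith [sq_nonneg (|u| - |x| * |v|)]

lemma tendsto_abs_log_of_hasDerivAt {g : ℝ → ℝ} {d s : ℝ} {S : Set ℝ} (hg : HasDerivAt g d s)
    (hd : d ≠ 0) (h0 : g s = 0) (hs : s ∉ S) :
    Tendsto (fun z => |Real.log (g z)|) (𝓝[S] s) atTop := by
  have h1 : Tendsto g (𝓝[S] s) (𝓝[≠] 0) := by
    have := hg.tendsto_nhdsNE hd
    rw [h0] at this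
    exact this.mono_left (nhdsWithin_mono _ fun z hz h => hs (by rwa [← mem_singleton_iff.1 h]))
  exact tendsto_abs_atBot_atTop.comp (Real.tendsto_log_nhdsNE_zero.comp h1)

lemma eq_or_eq_of_mem_closure_Ioo {a b s : ℝ} (h : s ∈ closure (Ioo a b)) (hs : s ∉ Ioo a b) :
    s = a ∨ s = b := by
  have h1 : s ∈ Icc a b := closure_minimal Ioo_subset_Icc_self isClosed_Icc h
  by_contra! hcon
  exact hs ⟨lt_of_le_of_ne h1.1 hcon.1.symm, lt_of_le_of_ne h1.2 hcon.2⟩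

lemma exists_eq_of_mem_closure_iUnion_Ioo {K : Finset ℤ} {a b : ℤ → ℝ} {s : ℝ}
    (h : s ∈ closure (⋃ k ∈ K, Ioo (a k) (b k))) (hs : s ∉ ⋃ k ∈ K, Ioo (a k) (b k)) :
    ∃ k ∈ K, s = a k ∨ s = b k := by
  rw [Finset.closure_biUnion] at h
  simp only [mem_iUnion, exists_prop, not_exists, not_and] at h hs
  obtain ⟨k, hk, h⟩ := h
  exact ⟨k, hk, eq_or_eq_of_mem_closure_Ioo h (hs k hk)⟩

/-! ### Trigonometric functions -/

lemma cos_ne_zero_of_mem_Ioo_int {k : ℤ} {x : ℝ}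
    (h : x ∈ Ioo ((k : ℝ) * Real.pi - Real.pi / 2) ((k : ℝ) * Real.pi + Real.pi / 2)) :
    Real.cos x ≠ 0 := by
  intro h0
  obtain ⟨m, rfl⟩ := Real.cos_eq_zero_iff.1 h0
  have h1 : ((k : ℝ) - 1) < m := by
    have := h.1
    by_contra! hc
    nlinarith [Real.pi_pos]
  have h2 : (m : ℝ) < k := by
    have := h.2
    by_contra! hc
    nlinarith [Real.pi_pos]
  have h1' : k - 1 < m := by exact_mod_cast h1
  have h2' : m < k := by exact_mod_cast h2
  omega

lemma sin_ne_zero_of_mem_Ioo_int {k : ℤ} {x : ℝ}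
    (h : x ∈ Ioo ((k : ℝ) * Real.pi) ((k : ℝ) * Real.pi + Real.pi)) : Real.sin x ≠ 0 := by
  intro h0
  obtain ⟨m, rfl⟩ := Real.sin_eq_zero_iff.1 h0
  have h1 : (k : ℝ) < m := by
    have := h.1
    by_contra! hc
    nlinarith [Real.pi_pos]
  have h2 : (m : ℝ) < k + 1 := by
    have := h.2
    by_contra! hc
    nlinarith [Real.pi_pos]
  have h1' : k < m := by exact_mod_cast h1
  have h2' : m < k + 1 := by exact_mod_cast h2
  omega

lemma cos_int_mul_pi_sub_pi_div_two (k : ℤ) : Real.cos (k * Real.pi - Real.pi / 2) = 0 := by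
  rw [Real.cos_sub_pi_div_two, Real.sin_int_mul_pi]

lemma cos_int_mul_pi_add_pi_div_two (k : ℤ) : Real.cos (k * Real.pi + Real.pi / 2) = 0 := by
  rw [Real.cos_add_pi_div_two, Real.sin_int_mul_pi, neg_zero]

lemma sin_int_mul_pi_add_pi (k : ℤ) : Real.sin (k * Real.pi + Real.pi) = 0 := by
  rw [Real.sin_add_pi, Real.sin_int_mul_pi, neg_zero]

lemma cos_ne_zero_of_sin_eq_zero {x : ℝ} (h : Real.sin x = 0) : Real.cos x ≠ 0 := by
  intro h'
  have := Real.sin_sq_add_cos_sq x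
  simp [h, h'] at this

lemma abs_le_max_of_le {a b c x : ℝ} (h1 : a * c ≤ x) (h2 : x ≤ b * c) (hc : 0 ≤ c) :
    |x| ≤ max |a| |b| * c := by
  rw [abs_le]
  constructor
  · have : -max |a| |b| ≤ a := by linarith [neg_abs_le a, le_max_left |a| |b|]
    nlinarith
  · have : b ≤ max |a| |b| := (le_abs_self b).trans (le_max_right _ _)
    nlinarith

theorem amenableWith_sin (k₁ k₂ : ℤ) :
    AmenableWith Real.sin (Ioo (k₁ * Real.pi) (k₂ * Real.pi))
      (fun x => x * Real.cos x / Real.sin x)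
      (((max |k₁| |k₂| : ℤ) : ℝ) ^ 2 * Real.pi ^ 2) := by
  refine amenableWith_of_hasDerivAt (f' := Real.cos) (f'' := fun x => -Real.sin x) isOpen_Ioo
    (by positivity) (fun x _ => Real.hasDerivAt_sin x) (fun x _ => Real.hasDerivAt_cos x)
    (fun _ _ _ _ => rfl) (fun x _ _ h => cos_ne_zero_of_sin_eq_zero h) ?_ ?_
  · intro s hs hsS _
    have h0 : Real.sin s = 0 := by
      rcases eq_or_eq_of_mem_closure_Ioo hs hsS with rfl | rfl <;> exact Real.sin_int_mul_pi _
    exact tendsto_abs_log_of_hasDerivAt (Real.hasDerivAt_sin s) (cos_ne_zero_of_sin_eq_zero h0) h0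
      hsS
  · intro x hx _ _
    have hx2 := pow_le_pow_left₀ (abs_nonneg x)
      (abs_le_max_of_le hx.1.le hx.2.le Real.pi_pos.le) 2
    rw [sq_abs, mul_pow] at hx2
    push_cast
    rw [abs_le]
    constructor
    · nlinarith [mul_le_mul_of_nonneg_right hx2 (sq_nonneg (Real.sin x)),
        mul_nonneg (sq_nonneg (max |(k₁ : ℝ)| |(k₂ : ℝ)| * Real.pi)) (sq_nonneg (x * Real.cos x))]
    · nlinarith [mul_nonneg (sq_nonneg (max |(k₁ : ℝ)| |(k₂ : ℝ)| * Real.pi))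
        (add_nonneg (sq_nonneg (Real.sin x)) (sq_nonneg (x * Real.cos x))),
        sq_nonneg (x * Real.sin x)]

/-- The bound on `H` for `cos`. It is clear if `x² ≤ A = (1 + u²) π²`. Otherwise, with
`|x| = u π + s`, one has `x² - A ≤ (1 + u²) s²`, while Jordan's inequality gives
`|sin x| = sin s ≥ 2 s / π`. -/
lemma sq_mul_cos_sq_le {u x : ℝ} (k : ℕ) (hu : u = k)
    (hx : |x| ≤ u * Real.pi + Real.pi / 2) :
    x ^ 2 * Real.cos x ^ 2 ≤
      (1 + u ^ 2) * Real.pi ^ 2 * (Real.cos x ^ 2 + x ^ 2 * Real.sin x ^ 2) := by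
  have hu0 : 0 ≤ u := by rw [hu]; positivity
  have hπ := Real.pi_pos
  set A := (1 + u ^ 2) * Real.pi ^ 2 with hA
  have hApos : 0 < A := by positivity
  rcases le_total (x ^ 2) A with h | h
  · nlinarith [mul_le_mul_of_nonneg_right h (sq_nonneg (Real.cos x)),
      mul_nonneg hApos.le (sq_nonneg (x * Real.sin x))]
  set s := |x| - u * Real.pi with hs
  have hs1 : s ≤ Real.pi / 2 := by linarith
  have hs0 : 0 ≤ s := by
    have h1 : (u * Real.pi) ^ 2 ≤ |x| ^ 2 := by rw [sq_abs]; nlinarith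
    have := abs_le_of_sq_le_sq' h1 (abs_nonneg x)
    linarith [this.2]
  have hsin : Real.sin x ^ 2 = Real.sin s ^ 2 := by
    have h1 : Real.sin |x| ^ 2 = Real.sin x ^ 2 := by
      rcases abs_choice x with h | h <;> rw [h]
      rw [Real.sin_neg, neg_sq]
    rw [← h1, hs, hu, Real.sin_sub_nat_mul_pi, mul_pow, ← pow_mul, mul_comm k 2, pow_mul]
    norm_num
  have hJ := Real.mul_le_sin hs0 hs1
  have hJ2 : 4 * s ^ 2 ≤ Real.pi ^ 2 * Real.sin x ^ 2 := by
    rw [hsin]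
    have h1 := pow_le_pow_left₀ (by positivity) hJ 2
    calc 4 * s ^ 2 = Real.pi ^ 2 * (2 / Real.pi * s) ^ 2 := by field_simp; ring
      _ ≤ _ := mul_le_mul_of_nonneg_left h1 (by positivity)
  have hxA : x ^ 2 - A ≤ A ^ 2 * Real.sin x ^ 2 := by
    have h1 : x ^ 2 = (u * Real.pi + s) ^ 2 := by rw [← sq_abs x]; congr 1; linarith
    have h2 : x ^ 2 - A ≤ (1 + u ^ 2) * s ^ 2 := by
      rw [h1, hA]; nlinarith [sq_nonneg (Real.pi - u * s)]
    have h3 : A ^ 2 * Real.sin x ^ 2 =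
        (1 + u ^ 2) ^ 2 * Real.pi ^ 2 * (Real.pi ^ 2 * Real.sin x ^ 2) := by
      rw [hA]; ring
    have h4 : (1 + u ^ 2) ^ 2 * Real.pi ^ 2 * (4 * s ^ 2) ≤
        (1 + u ^ 2) ^ 2 * Real.pi ^ 2 * (Real.pi ^ 2 * Real.sin x ^ 2) :=
      mul_le_mul_of_nonneg_left hJ2 (by positivity)
    have h5 : (1 + u ^ 2) * s ^ 2 ≤ (1 + u ^ 2) ^ 2 * Real.pi ^ 2 * (4 * s ^ 2) := by
      have : 1 ≤ (1 + u ^ 2) * Real.pi ^ 2 * 4 := by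
        nlinarith [Real.pi_gt_three, sq_nonneg (u * Real.pi)]
      nlinarith [mul_le_mul_of_nonneg_right this (by positivity : 0 ≤ (1 + u ^ 2) * s ^ 2)]
    linarith
  have h6 : A ^ 2 * Real.sin x ^ 2 ≤ A * (x ^ 2 * Real.sin x ^ 2) := by
    nlinarith [mul_le_mul_of_nonneg_right h (by positivity : 0 ≤ A * Real.sin x ^ 2)]
  have h7 : Real.cos x ^ 2 ≤ 1 := Real.cos_sq_le_one x
  nlinarith [mul_le_mul_of_nonneg_left h7 (sub_nonneg.2 h)]

theorem amenableWith_cos (k₁ k₂ : ℤ) :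
    AmenableWith Real.cos (Ioo (k₁ * Real.pi - Real.pi / 2) (k₂ * Real.pi + Real.pi / 2))
      (fun x => -(x * Real.sin x / Real.cos x))
      ((1 + ((max |k₁| |k₂| : ℤ) : ℝ) ^ 2) * Real.pi ^ 2) := by
  have hne : ∀ x, Real.cos x = 0 → -Real.sin x ≠ 0 := fun x h h' =>
    cos_ne_zero_of_sin_eq_zero (neg_eq_zero.1 h') h
  refine amenableWith_of_hasDerivAt (f' := fun x => -Real.sin x) (f'' := fun x => -Real.cos x)
    isOpen_Ioo (by positivity) (fun x _ => Real.hasDerivAt_cos x)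
    (fun x _ => (Real.hasDerivAt_sin x).neg) (fun x _ _ _ => by congr 1; ring)
    (fun x _ _ h => hne x h) ?_ ?_
  · intro s hs hsS _
    have h0 : Real.cos s = 0 := by
      rcases eq_or_eq_of_mem_closure_Ioo hs hsS with rfl | rfl
      · exact cos_int_mul_pi_sub_pi_div_two _
      · exact cos_int_mul_pi_add_pi_div_two _
    exact tendsto_abs_log_of_hasDerivAt (Real.hasDerivAt_cos s) (hne s h0) h0 hsS
  · intro x hx _ _
    have hπ := Real.pi_pos
    have hx' : |x| ≤ ((max |k₁| |k₂| : ℤ) : ℝ) * Real.pi + Real.pi / 2 := by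
      push_cast
      have h1 : -max |(k₁ : ℝ)| |(k₂ : ℝ)| ≤ k₁ := by
        linarith [neg_abs_le (k₁ : ℝ), le_max_left |(k₁ : ℝ)| |(k₂ : ℝ)|]
      have h2 : (k₂ : ℝ) ≤ max |(k₁ : ℝ)| |(k₂ : ℝ)| :=
        (le_abs_self _).trans (le_max_right _ _)
      rw [abs_le]
      constructor
      · nlinarith [hx.1]
      · nlinarith [hx.2]
    have h := sq_mul_cos_sq_le (max |k₁| |k₂|).toNat (by
      have : ((max |k₁| |k₂|).toNat : ℤ) = max |k₁| |k₂| :=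
        Int.toNat_of_nonneg ((abs_nonneg _).trans (le_max_left _ _))
      exact_mod_cast this.symm) hx'
    rw [show x ^ 2 * Real.cos x * -Real.cos x = -(x ^ 2 * Real.cos x ^ 2) by ring, abs_neg,
      abs_of_nonneg (by positivity), neg_sq]
    exact h

lemma abs_two_mul_div_sin_two_mul (x : ℝ) :
    |2 * x / Real.sin (2 * x)| = |x / (Real.sin x * Real.cos x)| := by
  rw [Real.sin_two_mul, show 2 * Real.sin x * Real.cos x = 2 * (Real.sin x * Real.cos x) by ring,
    mul_div_mul_left _ _ two_ne_zero]

theorem amenableWith_tan (K : Finset ℤ) :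
    AmenableWith Real.tan
      (⋃ k ∈ K, Ioo ((k : ℝ) * Real.pi - Real.pi / 2) ((k : ℝ) * Real.pi + Real.pi / 2))
      (fun x => 2 * x / Real.sin (2 * x)) 2 := by
  have hc : ∀ x ∈ ⋃ k ∈ K, Ioo ((k : ℝ) * Real.pi - Real.pi / 2) ((k : ℝ) * Real.pi + Real.pi / 2),
      Real.cos x ≠ 0 := by
    intro x hx
    simp only [mem_iUnion, exists_prop] at hx
    obtain ⟨k, _, hk⟩ := hx
    exact cos_ne_zero_of_mem_Ioo_int hk
  refine amenableWith_of_hasDerivAt (f' := fun x => 1 / Real.cos x ^ 2)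
    (f'' := fun x => 2 * Real.sin x / Real.cos x ^ 3)
    (isOpen_biUnion fun _ _ => isOpen_Ioo) zero_le_two
    (fun x hx => Real.hasDerivAt_tan (hc x hx)) ?_ ?_ ?_ ?_ ?_
  · intro x hx
    have h := hc x hx
    refine ((hasDerivAt_const x (1 : ℝ)).div ((Real.hasDerivAt_cos x).pow 2)
      (pow_ne_zero 2 h)).congr_deriv ?_
    simp
    field_simp
  · intro x hx _ ht
    have h := hc x hx
    rw [abs_two_mul_div_sin_two_mul, Real.tan_eq_sin_div_cos]
    congr 1
    field_simp
  · intro x hx _ _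
    exact one_div_ne_zero (pow_ne_zero 2 (hc x hx))
  · intro s hs hsS _
    obtain ⟨k, _, h⟩ := exists_eq_of_mem_closure_iUnion_Ioo hs hsS
    have h0 : Real.cos s = 0 := by
      rcases h with rfl | rfl
      · exact cos_int_mul_pi_sub_pi_div_two _
      · exact cos_int_mul_pi_add_pi_div_two _
    have h1 := (Real.tendsto_abs_tan_of_cos_eq_zero h0).mono_left
      (nhdsWithin_mono s fun z hz h => hsS (by rwa [← mem_singleton_iff.1 h]))
    refine (tendsto_abs_atTop_atTop.comp (Real.tendsto_log_atTop.comp h1)).congr fun z => ?_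
    simp [Real.log_abs]
  · intro x hx _ _
    have h := hc x hx
    rw [Real.tan_eq_sin_div_cos,
      show x ^ 2 * (Real.sin x / Real.cos x) * (2 * Real.sin x / Real.cos x ^ 3) =
        (2 * x ^ 2 * Real.sin x ^ 2) / Real.cos x ^ 4 by field_simp,
      show 2 * ((Real.sin x / Real.cos x) ^ 2 + x ^ 2 * (1 / Real.cos x ^ 2) ^ 2) =
        (2 * (Real.sin x ^ 2 * Real.cos x ^ 2 + x ^ 2)) / Real.cos x ^ 4 by field_simp,
      abs_of_nonneg (by positivity)]
    refine div_le_div_of_nonneg_right ?_ (by positivity)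
    nlinarith [Real.sin_sq_le_one x, sq_nonneg x, sq_nonneg (Real.sin x * Real.cos x),
      mul_le_mul_of_nonneg_left (Real.sin_sq_le_one x) (sq_nonneg x)]

/-- With `c, s` the cosine and sine of `x`, in either order, this bounds `H` for the functions
`1 / sin` and `1 / cos`. -/
lemma sq_mul_one_add_sq_le {x c s M : ℝ} (hcs : s ^ 2 + c ^ 2 = 1) (hM : 1 ≤ M) (hx : |x| ≤ M) :
    x ^ 2 * (1 + c ^ 2) ≤ 3 * M ^ 2 * (s ^ 2 + x ^ 2 * c ^ 2) := by
  have hx2 : x ^ 2 ≤ M ^ 2 := by rw [← sq_abs x]; gcongr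
  have hM2 : 1 ≤ M ^ 2 := one_le_pow₀ hM
  have hc : c ^ 2 ≤ 1 := by nlinarith [sq_nonneg s]
  have h2 : x ^ 2 * (1 + c ^ 2) ≤ x ^ 2 * 2 := mul_le_mul_of_nonneg_left (by linarith) (sq_nonneg x)
  rcases le_total 1 (x ^ 2) with h | h
  · have h1 : 1 ≤ s ^ 2 + x ^ 2 * c ^ 2 := by
      nlinarith [mul_le_mul_of_nonneg_right h (sq_nonneg c)]
    nlinarith [mul_le_mul_of_nonneg_left h1 (by positivity : 0 ≤ 3 * M ^ 2)]
  · have h1 : x ^ 2 ≤ s ^ 2 + x ^ 2 * c ^ 2 := by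
      nlinarith [mul_le_mul_of_nonneg_right h (sq_nonneg s)]
    nlinarith [mul_le_mul_of_nonneg_left h1 (by positivity : 0 ≤ 3 * M ^ 2),
      mul_le_mul_of_nonneg_right hM2 (sq_nonneg x)]

theorem amenableWith_one_div_sin (k : ℤ) :
    AmenableWith (fun x => 1 / Real.sin x) (Ioo (k * Real.pi) (k * Real.pi + Real.pi))
      (fun x => -(x * Real.cos x / Real.sin x)) (3 * (1 + |(k : ℝ)|) ^ 2 * Real.pi ^ 2) := by
  have hs : ∀ x ∈ Ioo ((k : ℝ) * Real.pi) (k * Real.pi + Real.pi), Real.sin x ≠ 0 := fun x hx =>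
    sin_ne_zero_of_mem_Ioo_int hx
  refine amenableWith_of_hasDerivAt (f' := fun x => -Real.cos x / Real.sin x ^ 2)
    (f'' := fun x => (1 + Real.cos x ^ 2) / Real.sin x ^ 3) isOpen_Ioo (by positivity)
    ?_ ?_ ?_ ?_ ?_ ?_
  · intro x hx
    refine ((hasDerivAt_const x (1 : ℝ)).div (Real.hasDerivAt_sin x) (hs x hx)).congr_deriv ?_
    simp
  · intro x hx
    have h := hs x hx
    refine ((Real.hasDerivAt_cos x).neg.div ((Real.hasDerivAt_sin x).pow 2)
      (pow_ne_zero 2 h)).congr_deriv ?_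
    simp only [Nat.cast_ofNat, Nat.add_one_sub_one, pow_one, neg_neg, Pi.neg_apply, Pi.pow_apply]
    field_simp
    linear_combination Real.sin_sq_add_cos_sq x
  · intro x hx _ _
    have h := hs x hx
    congr 1
    field_simp
  · intro x hx _ h
    exact absurd h (one_div_ne_zero (hs x hx))
  · intro s hs hsS _
    have h0 : Real.sin s = 0 := by
      rcases eq_or_eq_of_mem_closure_Ioo hs hsS with rfl | rfl
      · exact Real.sin_int_mul_pi _
      · exact sin_int_mul_pi_add_pi _
    refine (tendsto_abs_log_of_hasDerivAt (Real.hasDerivAt_sin s) (cos_ne_zero_of_sin_eq_zero h0)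
      h0 hsS).congr fun z => ?_
    rw [one_div, Real.log_inv, abs_neg]
  · intro x hx _ _
    have h := hs x hx
    have hM : |x| ≤ (1 + |(k : ℝ)|) * Real.pi := by
      rw [abs_le]
      constructor
      · nlinarith [hx.1, Real.pi_pos, neg_abs_le (k : ℝ)]
      · nlinarith [hx.2, Real.pi_pos, le_abs_self (k : ℝ)]
    have h1 := sq_mul_one_add_sq_le (Real.sin_sq_add_cos_sq x)
      (by nlinarith [Real.pi_gt_three, abs_nonneg (k : ℝ)]) hM
    rw [show x ^ 2 * (1 / Real.sin x) * ((1 + Real.cos x ^ 2) / Real.sin x ^ 3) =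
        (x ^ 2 * (1 + Real.cos x ^ 2)) / Real.sin x ^ 4 by field_simp,
      show 3 * (1 + |(k : ℝ)|) ^ 2 * Real.pi ^ 2 *
        ((1 / Real.sin x) ^ 2 + x ^ 2 * (-Real.cos x / Real.sin x ^ 2) ^ 2) =
        (3 * ((1 + |(k : ℝ)|) * Real.pi) ^ 2 * (Real.sin x ^ 2 + x ^ 2 * Real.cos x ^ 2)) /
          Real.sin x ^ 4 by field_simp,
      abs_of_nonneg (by positivity)]
    exact div_le_div_of_nonneg_right h1 (by positivity)

theorem amenableWith_one_div_cos (k : ℤ) :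
    AmenableWith (fun x => 1 / Real.cos x)
      (Ioo (k * Real.pi - Real.pi / 2) (k * Real.pi + Real.pi / 2))
      (fun x => x * Real.sin x / Real.cos x) (3 * (1 / 2 + |(k : ℝ)|) ^ 2 * Real.pi ^ 2) := by
  have hc : ∀ x ∈ Ioo ((k : ℝ) * Real.pi - Real.pi / 2) (k * Real.pi + Real.pi / 2),
      Real.cos x ≠ 0 := fun x hx => cos_ne_zero_of_mem_Ioo_int hx
  refine amenableWith_of_hasDerivAt (f' := fun x => Real.sin x / Real.cos x ^ 2)
    (f'' := fun x => (1 + Real.sin x ^ 2) / Real.cos x ^ 3) isOpen_Ioo (by positivity)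
    ?_ ?_ ?_ ?_ ?_ ?_
  · intro x hx
    refine ((hasDerivAt_const x (1 : ℝ)).div (Real.hasDerivAt_cos x) (hc x hx)).congr_deriv ?_
    simp
  · intro x hx
    have h := hc x hx
    refine ((Real.hasDerivAt_sin x).div ((Real.hasDerivAt_cos x).pow 2)
      (pow_ne_zero 2 h)).congr_deriv ?_
    simp only [Nat.cast_ofNat, Nat.add_one_sub_one, pow_one, Pi.pow_apply]
    field_simp
    linear_combination Real.sin_sq_add_cos_sq x
  · intro x hx _ _
    have h := hc x hx
    congr 1
    field_simp
  · intro x hx _ h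
    exact absurd h (one_div_ne_zero (hc x hx))
  · intro s hs hsS _
    have h0 : Real.cos s = 0 := by
      rcases eq_or_eq_of_mem_closure_Ioo hs hsS with rfl | rfl
      · exact cos_int_mul_pi_sub_pi_div_two _
      · exact cos_int_mul_pi_add_pi_div_two _
    refine (tendsto_abs_log_of_hasDerivAt (Real.hasDerivAt_cos s)
      (fun h' => cos_ne_zero_of_sin_eq_zero (neg_eq_zero.1 h') h0) h0 hsS).congr fun z => ?_
    rw [one_div, Real.log_inv, abs_neg]
  · intro x hx _ _
    have h := hc x hx
    have hM : |x| ≤ (1 / 2 + |(k : ℝ)|) * Real.pi := by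
      rw [abs_le]
      constructor
      · nlinarith [hx.1, Real.pi_pos, neg_abs_le (k : ℝ)]
      · nlinarith [hx.2, Real.pi_pos, le_abs_self (k : ℝ)]
    have h1 := sq_mul_one_add_sq_le (Real.cos_sq_add_sin_sq x)
      (by nlinarith [Real.pi_gt_three, abs_nonneg (k : ℝ)]) hM
    rw [show x ^ 2 * (1 / Real.cos x) * ((1 + Real.sin x ^ 2) / Real.cos x ^ 3) =
        (x ^ 2 * (1 + Real.sin x ^ 2)) / Real.cos x ^ 4 by field_simp,
      show 3 * (1 / 2 + |(k : ℝ)|) ^ 2 * Real.pi ^ 2 *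
        ((1 / Real.cos x) ^ 2 + x ^ 2 * (Real.sin x / Real.cos x ^ 2) ^ 2) =
        (3 * ((1 / 2 + |(k : ℝ)|) * Real.pi) ^ 2 * (Real.cos x ^ 2 + x ^ 2 * Real.sin x ^ 2)) /
          Real.cos x ^ 4 by field_simp,
      abs_of_nonneg (by positivity)]
    exact div_le_div_of_nonneg_right h1 (by positivity)

theorem amenableWith_cot (K : Finset ℤ) :
    AmenableWith Real.cot (⋃ k ∈ K, Ioo ((k : ℝ) * Real.pi) ((k : ℝ) * Real.pi + Real.pi))
      (fun x => 2 * x / Real.sin (2 * x)) 2 := by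
  have hs : ∀ x ∈ ⋃ k ∈ K, Ioo ((k : ℝ) * Real.pi) ((k : ℝ) * Real.pi + Real.pi),
      Real.sin x ≠ 0 := by
    intro x hx
    simp only [mem_iUnion, exists_prop] at hx
    obtain ⟨k, _, hk⟩ := hx
    exact sin_ne_zero_of_mem_Ioo_int hk
  have hcot : Real.cot = fun x => Real.cos x / Real.sin x :=
    funext fun x => Real.cot_eq_cos_div_sin x
  rw [hcot]
  refine amenableWith_of_hasDerivAt (f' := fun x => -1 / Real.sin x ^ 2)
    (f'' := fun x => 2 * Real.cos x / Real.sin x ^ 3)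
    (isOpen_biUnion fun _ _ => isOpen_Ioo) zero_le_two ?_ ?_ ?_ ?_ ?_ ?_
  · intro x hx
    refine ((Real.hasDerivAt_cos x).div (Real.hasDerivAt_sin x) (hs x hx)).congr_deriv ?_
    congr 1
    linear_combination -Real.sin_sq_add_cos_sq x
  · intro x hx
    have h := hs x hx
    refine ((hasDerivAt_const x (-1 : ℝ)).div ((Real.hasDerivAt_sin x).pow 2)
      (pow_ne_zero 2 h)).congr_deriv ?_
    simp
    field_simp
  · intro x hx _ ht
    have h := hs x hx
    rw [abs_two_mul_div_sin_two_mul, ← abs_neg]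
    congr 1
    field_simp
  · intro x hx _ _
    exact div_ne_zero (by norm_num) (pow_ne_zero 2 (hs x hx))
  · intro s hs hsS _
    obtain ⟨k, _, h⟩ := exists_eq_of_mem_closure_iUnion_Ioo hs hsS
    have h0 : Real.sin s = 0 := by
      rcases h with rfl | rfl
      · exact Real.sin_int_mul_pi _
      · exact sin_int_mul_pi_add_pi _
    have hc := cos_ne_zero_of_sin_eq_zero h0
    refine (tendsto_abs_log_of_hasDerivAt (Real.hasDerivAt_tan hc)
      (one_div_ne_zero (pow_ne_zero 2 hc)) (by simp [Real.tan_eq_sin_div_cos, h0])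
      hsS).congr fun z => ?_
    rw [Real.tan_eq_sin_div_cos, ← inv_div, Real.log_inv, abs_neg]
  · intro x hx _ _
    have h := hs x hx
    rw [show x ^ 2 * (Real.cos x / Real.sin x) * (2 * Real.cos x / Real.sin x ^ 3) =
        (2 * x ^ 2 * Real.cos x ^ 2) / Real.sin x ^ 4 by field_simp,
      show 2 * ((Real.cos x / Real.sin x) ^ 2 + x ^ 2 * (-1 / Real.sin x ^ 2) ^ 2) =
        (2 * (Real.cos x ^ 2 * Real.sin x ^ 2 + x ^ 2)) / Real.sin x ^ 4 by field_simp,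
      abs_of_nonneg (by positivity)]
    refine div_le_div_of_nonneg_right ?_ (by positivity)
    nlinarith [sq_nonneg (Real.sin x * Real.cos x),
      mul_le_mul_of_nonneg_left (Real.cos_sq_le_one x) (sq_nonneg x)]

/-! ### Exponential, logarithm, hyperbolic and inverse functions -/

lemma boundary_univ {p : ℝ → Prop} :
    ∀ s ∈ closure (univ : Set ℝ), s ∉ (univ : Set ℝ) → s ≠ 0 → p s :=
  fun s _ hs => absurd (mem_univ s) hs

/-- The half-line has no boundary point other than the origin, which is at infinite relative distance
from all its points. -/
lemma boundary_Ioi_zero {p : ℝ → Prop} :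
    ∀ s ∈ closure (Ioi (0 : ℝ)), s ∉ Ioi (0 : ℝ) → s ≠ 0 → p s := by
  intro s hs hs' h0
  rw [closure_Ioi] at hs
  exact absurd (lt_of_le_of_ne hs h0.symm) hs'

theorem amenableWith_exp : AmenableWith Real.exp univ (fun x => x) 1 := by
  refine amenableWith_of_hasDerivAt (f' := Real.exp) (f'' := Real.exp) isOpen_univ zero_le_one
    (fun x _ => Real.hasDerivAt_exp x) (fun x _ => Real.hasDerivAt_exp x) ?_
    (fun x _ _ h => absurd h (Real.exp_ne_zero x)) boundary_univ ?_
  · intro x _ _ h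
    congr 1
    field_simp
  · intro x _ _ _
    rw [mul_assoc, abs_of_nonneg (by positivity)]
    nlinarith [sq_nonneg (Real.exp x)]

theorem amenableWith_log : AmenableWith Real.log (Ioi 0) (fun x => 1 / Real.log x) 1 := by
  refine amenableWith_of_hasDerivAt (f' := fun x => x⁻¹) (f'' := fun x => -(x ^ 2)⁻¹) isOpen_Ioi
    zero_le_one (fun x hx => Real.hasDerivAt_log (ne_of_gt hx))
    (fun x hx => hasDerivAt_inv (ne_of_gt hx)) ?_
    (fun x _ h0 _ => inv_ne_zero h0) boundary_Ioi_zero ?_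
  · intro x _ h0 h
    congr 1
    field_simp
  · intro x _ h0 _
    apply abs_le_of_abs_mul_le_two_mul
    rw [show x * -(x ^ 2)⁻¹ = -x⁻¹ by field_simp, abs_neg]
    linarith [abs_nonneg x⁻¹]

theorem amenableWith_sinh :
    AmenableWith Real.sinh univ (fun x => x * Real.cosh x / Real.sinh x) 1 := by
  refine amenableWith_of_hasDerivAt (f' := Real.cosh) (f'' := Real.sinh) isOpen_univ zero_le_one
    (fun x _ => Real.hasDerivAt_sinh x) (fun x _ => Real.hasDerivAt_cosh x) (fun _ _ _ _ => rfl)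
    (fun x _ _ _ => (Real.cosh_pos x).ne') boundary_univ ?_
  intro x _ _ _
  rw [mul_assoc, ← sq, abs_of_nonneg (by positivity)]
  nlinarith [Real.cosh_sq x, sq_nonneg x, sq_nonneg (Real.sinh x),
    mul_nonneg (sq_nonneg x) (sq_nonneg (Real.sinh x))]

theorem amenableWith_cosh :
    AmenableWith Real.cosh univ (fun x => x * Real.sinh x / Real.cosh x) 1 := by
  refine amenableWith_of_hasDerivAt (f' := Real.sinh) (f'' := Real.cosh) isOpen_univ zero_le_one
    (fun x _ => Real.hasDerivAt_cosh x) (fun x _ => Real.hasDerivAt_sinh x) (fun _ _ _ _ => rfl)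
    (fun x _ _ h => absurd h (Real.cosh_pos x).ne') boundary_univ ?_
  intro x _ _ _
  have hx : x ^ 2 ≤ Real.sinh x ^ 2 := by
    have h : |x| ≤ Real.sinh |x| := Real.self_le_sinh_iff.2 (abs_nonneg x)
    rw [← Real.abs_sinh] at h
    exact sq_le_sq.2 h
  rw [mul_assoc, ← sq, abs_of_nonneg (by positivity)]
  nlinarith [Real.cosh_sq x]

theorem amenableWith_arctan :
    AmenableWith Real.arctan univ (fun x => x / (x ^ 2 + 1) / Real.arctan x) 1 := by
  refine amenableWith_of_hasDerivAt (f' := fun x => 1 / (1 + x ^ 2))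
    (f'' := fun x => -(2 * x) / (1 + x ^ 2) ^ 2) isOpen_univ zero_le_one
    (fun x _ => Real.hasDerivAt_arctan x) ?_ ?_ (fun x _ _ _ => by positivity) boundary_univ ?_
  · intro x _
    refine ((hasDerivAt_const x (1 : ℝ)).div (((hasDerivAt_id x).pow 2).const_add 1)
      (by simp only [Pi.pow_apply, id]; positivity)).congr_deriv ?_
    simp
  · intro x _ _ _
    rw [add_comm, mul_one_div]
  · intro x _ _ _
    apply abs_le_of_abs_mul_le_two_mul
    rw [show x * (-(2 * x) / (1 + x ^ 2) ^ 2) = -(2 * x ^ 2 / (1 + x ^ 2) ^ 2) by ring, abs_neg,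
      abs_of_nonneg (by positivity), abs_of_nonneg (by positivity),
      show 2 * (1 / (1 + x ^ 2)) = 2 * (1 + x ^ 2) / (1 + x ^ 2) ^ 2 by field_simp]
    refine div_le_div_of_nonneg_right ?_ (by positivity)
    linarith

theorem amenableWith_arsinh :
    AmenableWith Real.arsinh univ (fun x => x / √(x ^ 2 + 1) / Real.arsinh x) 1 := by
  refine amenableWith_of_hasDerivAt (f' := fun x => (√(1 + x ^ 2))⁻¹)
    (f'' := fun x => -(x / √(1 + x ^ 2)) / √(1 + x ^ 2) ^ 2) isOpen_univ zero_le_one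
    (fun x _ => Real.hasDerivAt_arsinh x) ?_ ?_ (fun x _ _ _ => by positivity) boundary_univ ?_
  · intro x _
    have h : HasDerivAt (fun x : ℝ => √(1 + x ^ 2)) (x / √(1 + x ^ 2)) x := by
      refine ((((hasDerivAt_id x).pow 2).const_add 1).sqrt
        (by simp only [Pi.pow_apply, id]; positivity)).congr_deriv ?_
      simp only [Pi.pow_apply, id]
      field_simp
      simp
    exact h.inv (by positivity)
  · intro x _ _ _
    rw [add_comm, div_eq_mul_inv x]
  · intro x _ _ _
    apply abs_le_of_abs_mul_le_two_mul
    have h1 : 0 < √(1 + x ^ 2) := by positivity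
    have h2 : √(1 + x ^ 2) ^ 2 = 1 + x ^ 2 := Real.sq_sqrt (by positivity)
    rw [show x * (-(x / √(1 + x ^ 2)) / √(1 + x ^ 2) ^ 2) =
        -(x ^ 2 / √(1 + x ^ 2) ^ 2 * (√(1 + x ^ 2))⁻¹) by field_simp, abs_neg,
      abs_of_nonneg (by positivity), abs_of_nonneg (by positivity), h2]
    refine mul_le_mul_of_nonneg_right ?_ (by positivity)
    rw [div_le_iff₀ (by positivity)]
    nlinarith [sq_nonneg x]

/-- The bound on `H` for `arcosh`, with `x = cosh a` and `s = sinh a`: for small `a` it follows from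
`a ≤ sinh a`, and otherwise from the inequality of the arithmetic and geometric means. -/
lemma mul_cosh_cube_le {a c s : ℝ} (ha : 0 < a) (hs : a ≤ s) (hc : 0 < c)
    (hcs : c ^ 2 = s ^ 2 + 1) :
    a * c ^ 3 ≤ 2 * (s * (a ^ 2 * s ^ 2 + c ^ 2)) := by
  have hs0 : 0 < s := ha.trans_le hs
  rcases le_total c 2 with h | h
  · have h1 : a * c ^ 3 ≤ s * c ^ 3 := mul_le_mul_of_nonneg_right hs (by positivity)
    have h2 : s * c ^ 3 ≤ s * (2 * c ^ 2) :=
      mul_le_mul_of_nonneg_left (by nlinarith [sq_nonneg c]) hs0.le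
    nlinarith [mul_nonneg hs0.le (sq_nonneg (a * s))]
  · have h1 : c ^ 2 ≤ 4 * s ^ 2 := by nlinarith
    have h2 : a * c * c ^ 2 ≤ a * c * (4 * s ^ 2) := mul_le_mul_of_nonneg_left h1 (by positivity)
    nlinarith [mul_nonneg hs0.le (sq_nonneg (a * s - c))]

theorem amenableWith_arcosh :
    AmenableWith Real.arcosh (Ioi 1) (fun x => x / √(x ^ 2 - 1) / Real.arcosh x) 2 := by
  have hpos : ∀ x ∈ Ioi (1 : ℝ), 0 < x ^ 2 - 1 := fun x hx => by
    have : (1 : ℝ) < x := hx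
    nlinarith
  have harc : ∀ x ∈ Ioi (1 : ℝ), 0 < Real.arcosh x := fun x hx => Real.arcosh_pos hx
  refine amenableWith_of_hasDerivAt (f' := fun x => (√(x ^ 2 - 1))⁻¹)
    (f'' := fun x => -(x / √(x ^ 2 - 1)) / √(x ^ 2 - 1) ^ 2) isOpen_Ioi zero_le_two
    (fun x hx => Real.hasDerivAt_arcosh hx) ?_ ?_ (fun x hx _ h => absurd h (harc x hx).ne') ?_ ?_
  · intro x hx
    have h0 := hpos x hx
    have h : HasDerivAt (fun x : ℝ => √(x ^ 2 - 1)) (x / √(x ^ 2 - 1)) x := by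
      refine ((((hasDerivAt_id x).pow 2).sub_const 1).sqrt
        (by simp only [Pi.pow_apply, id]; exact h0.ne')).congr_deriv ?_
      simp only [Pi.pow_apply, id]
      field_simp
      simp
    exact h.inv (Real.sqrt_pos.2 h0).ne'
  · intro x _ _ _
    rw [div_eq_mul_inv x]
  · intro s hs hs' _
    have h1 : s = 1 := by
      rw [closure_Ioi] at hs
      exact le_antisymm (not_lt.1 hs') hs
    rw [h1]
    have h2 : Tendsto Real.arcosh (𝓝[Ioi 1] 1) (𝓝[≠] 0) := by
      refine tendsto_nhdsWithin_iff.2 ⟨?_, ?_⟩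
      · have := Real.continuousOn_arcosh 1 self_mem_Ici
        rw [ContinuousWithinAt, Real.arcosh_zero] at this
        exact this.mono_left (nhdsWithin_mono _ Ioi_subset_Ici_self)
      · filter_upwards [self_mem_nhdsWithin] with z hz using (harc z hz).ne'
    exact tendsto_abs_atBot_atTop.comp (Real.tendsto_log_nhdsNE_zero.comp h2)
  · intro x hx _ _
    have hx1 : (1 : ℝ) < x := hx
    have hs := Real.sqrt_pos.2 (hpos x hx)
    have ha := harc x hx
    have hs2 := Real.sq_sqrt (hpos x hx).le
    have has : Real.arcosh x ≤ √(x ^ 2 - 1) := by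
      rw [← Real.sinh_arcosh hx1.le]
      exact Real.self_le_sinh_iff.2 ha.le
    have h := mul_cosh_cube_le (c := x) ha has (by linarith) (by rw [hs2]; ring)
    set a := Real.arcosh x
    set s := √(x ^ 2 - 1)
    have hx0 : 0 < x := by linarith
    rw [show x ^ 2 * a * (-(x / s) / s ^ 2) = -(a * x ^ 3 / s ^ 3) by field_simp, abs_neg,
      abs_of_nonneg (by positivity),
      show 2 * (a ^ 2 + x ^ 2 * s⁻¹ ^ 2) = 2 * (s * (a ^ 2 * s ^ 2 + x ^ 2)) / s ^ 3 by field_simp]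
    exact div_le_div_of_nonneg_right h (by positivity)

theorem amenableWith_sin_log :
    AmenableWith (fun x => Real.sin (Real.log x)) (Ioi 0)
      (fun x => Real.cos (Real.log x) / Real.sin (Real.log x)) ((1 + √2) / 2) := by
  refine amenableWith_of_hasDerivAt (f' := fun x => Real.cos (Real.log x) / x)
    (f'' := fun x => (-Real.sin (Real.log x) - Real.cos (Real.log x)) / x ^ 2) isOpen_Ioi
    (by positivity) ?_ ?_ ?_ ?_ boundary_Ioi_zero ?_
  · intro x hx
    exact (Real.hasDerivAt_log (ne_of_gt hx)).sin
  · intro x hx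
    have hx0 : x ≠ 0 := ne_of_gt hx
    refine ((Real.hasDerivAt_log hx0).cos.div (hasDerivAt_id x) hx0).congr_deriv ?_
    simp only [id]
    field_simp
  · intro x _ h0 _
    congr 1
    field_simp
  · intro x _ h0 h
    exact div_ne_zero (cos_ne_zero_of_sin_eq_zero h) h0
  · intro x _ h0 _
    set s := Real.sin (Real.log x)
    set c := Real.cos (Real.log x)
    have hsc : s ^ 2 + c ^ 2 = 1 := Real.sin_sq_add_cos_sq _
    rw [show x ^ 2 * s * ((-s - c) / x ^ 2) = -(s ^ 2 + s * c) by field_simp; ring,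
      show s ^ 2 + x ^ 2 * (c / x) ^ 2 = 1 by rw [← hsc]; field_simp, abs_neg, mul_one]
    have h2 : √2 ^ 2 = 2 := Real.sq_sqrt zero_le_two
    -- `2 (s² + s c) - 1 = (s² - c²) + 2 s c` is `sin - cos` of the doubled angle.
    have h3 : |(s ^ 2 - c ^ 2) + 2 * s * c| ≤ √2 := by
      apply Real.abs_le_sqrt
      nlinarith [sq_nonneg ((s ^ 2 - c ^ 2) - 2 * s * c)]
    have h4 := abs_le.1 h3
    rw [abs_le]
    constructor <;> nlinarith [Real.one_le_sqrt.2 (one_le_two : (1 : ℝ) ≤ 2)]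

/-! ### The Gamma and digamma functions -/

lemma hasDerivAt_Gamma_of_pos {x : ℝ} (hx : 0 < x) :
    HasDerivAt Real.Gamma (Real.Gamma x * realDigamma x) x := by
  have h := (Real.differentiableAt_Gamma (s := x) fun m => by
    have : (0 : ℝ) ≤ m := m.cast_nonneg
    linarith).hasDerivAt
  refine h.congr_deriv ?_
  rw [realDigamma, logDeriv_apply, mul_div_cancel₀ _ (Real.Gamma_pos_of_pos hx).ne']

lemma realDigamma_add_one {x : ℝ} (hx : 0 < x) : realDigamma (x + 1) = realDigamma x + 1 / x := by
  have hΓ := (Real.Gamma_pos_of_pos hx).ne'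
  have h1 : HasDerivAt (fun y => Real.Gamma (y + 1)) _ x :=
    (hasDerivAt_Gamma_of_pos (by linarith : 0 < x + 1)).comp_add_const x 1
  have h2 : HasDerivAt (fun y => y * Real.Gamma y) _ x :=
    (hasDerivAt_id x).mul (hasDerivAt_Gamma_of_pos hx)
  have h3 := h1.unique (h2.congr_of_eventuallyEq (by
    filter_upwards [lt_mem_nhds hx] with y hy using Real.Gamma_add_one hy.ne'))
  rw [Real.Gamma_add_one hx.ne'] at h3
  simp only [id] at h3
  field_simp at h3 ⊢
  linarith

lemma realDigamma_monotoneOn : MonotoneOn realDigamma (Ioi 0) := by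
  have h : ∀ x ∈ Ioi (0 : ℝ), HasDerivAt (Real.log ∘ Real.Gamma) (realDigamma x) x := fun x hx => by
    have hΓ := (Real.Gamma_pos_of_pos hx).ne'
    refine ((hasDerivAt_Gamma_of_pos hx).log hΓ).congr_deriv ?_
    field_simp
  refine (Real.convexOn_log_Gamma.monotoneOn_deriv fun x hx => (h x hx).differentiableAt).congr ?_
  exact fun x hx => (h x hx).deriv

lemma realDigamma_add_nat {x : ℝ} (hx : 0 < x) (n : ℕ) :
    realDigamma (x + n) = realDigamma x + ∑ m ∈ Finset.range n, 1 / (x + m) := by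
  induction n with
  | zero => simp
  | succ n ih =>
    rw [Finset.sum_range_succ, ← add_assoc, ← ih, Nat.cast_succ, ← add_assoc,
      realDigamma_add_one (by positivity)]

/-- Since `ψ` is increasing, `ψ (y + n) - ψ (x + n)` is at most `ψ (x + N + n) - ψ (x + n)` for an
integer `N ≥ y - x`, and this is a sum of `N` terms that are at most `1 / (x + n)`. -/
lemma tendsto_realDigamma_add_nat_sub {x y : ℝ} (hx : 0 < x) (hxy : x ≤ y) :
    Tendsto (fun n : ℕ => realDigamma (y + n) - realDigamma (x + n)) atTop (𝓝 0) := by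
  obtain ⟨N, hN⟩ := exists_nat_ge (y - x)
  have hy : 0 < y := hx.trans_le hxy
  have hlim : Tendsto (fun n : ℕ => (N : ℝ) * (1 / (x + n))) atTop (𝓝 0) := by
    have : Tendsto (fun n : ℕ => (N : ℝ) * (x + n)⁻¹) atTop (𝓝 (N * 0)) :=
      (tendsto_inv_atTop_zero.comp
        (tendsto_atTop_add_const_left _ x tendsto_natCast_atTop_atTop)).const_mul _
    simpa using this
  refine squeeze_zero (fun n => ?_) (fun n => ?_) hlim
  · exact sub_nonneg.2 (realDigamma_monotoneOn (mem_Ioi.2 (by positivity))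
      (mem_Ioi.2 (by positivity)) (by linarith))
  · have h1 : realDigamma (y + n) ≤ realDigamma (x + n + N) :=
      realDigamma_monotoneOn (mem_Ioi.2 (by positivity)) (mem_Ioi.2 (by positivity)) (by linarith)
    rw [realDigamma_add_nat (x := x + n) (by positivity)] at h1
    have h2 : ∑ m ∈ Finset.range N, 1 / (x + n + m) ≤ ∑ _m ∈ Finset.range N, 1 / (x + n) :=
      Finset.sum_le_sum fun m _ => one_div_le_one_div_of_le (by positivity) (by simp)
    simp only [Finset.sum_const, Finset.card_range, nsmul_eq_mul] at h2
    linarith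

lemma hasSum_realDigamma_sub {x y : ℝ} (hx : 0 < x) (hxy : x ≤ y) :
    HasSum (fun m : ℕ => 1 / (x + m) - 1 / (y + m)) (realDigamma y - realDigamma x) := by
  have hy : 0 < y := hx.trans_le hxy
  rw [hasSum_iff_tendsto_nat_of_nonneg fun m => sub_nonneg.2
    (one_div_le_one_div_of_le (by positivity) (by linarith))]
  have h := (tendsto_realDigamma_add_nat_sub hx hxy).const_sub (realDigamma y - realDigamma x)
  rw [sub_zero] at h
  refine h.congr fun n => ?_
  rw [realDigamma_add_nat hx, realDigamma_add_nat hy, Finset.sum_sub_distrib]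
  ring

lemma summable_one_div_add_sq {x : ℝ} (hx : 0 < x) : Summable fun m : ℕ => 1 / (x + m) ^ 2 := by
  refine ((Real.summable_one_div_nat_add_rpow x 2).2 one_lt_two).congr fun m => ?_
  rw [abs_of_pos (by positivity), Real.rpow_two, add_comm]

/-- The derivative `ψ'` of the digamma function on `(0, ∞)`, as a series. -/
noncomputable def trigamma (x : ℝ) : ℝ := ∑' m : ℕ, 1 / (x + m) ^ 2

/-- The second derivative `ψ''` of the digamma function on `(0, ∞)`, as a series. -/
noncomputable def tetragamma (x : ℝ) : ℝ := ∑' m : ℕ, -2 / (x + m) ^ 3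

lemma hasDerivAt_realDigamma {x : ℝ} (hx : 0 < x) : HasDerivAt realDigamma (trigamma x) x := by
  have hδ : 0 < x / 2 := by positivity
  have h := hasDerivAt_tsum_of_isPreconnected (t := Ioi (x / 2)) (y := x) (y₀ := x)
    (g := fun (m : ℕ) y => 1 / (x / 2 + m) - 1 / (y + m))
    (g' := fun (m : ℕ) y => 1 / (y + m) ^ 2)
    (summable_one_div_add_sq hδ) isOpen_Ioi isPreconnected_Ioi
    (fun m y hy => by
      have hy' : 0 < y + m := add_pos_of_pos_of_nonneg (hδ.trans hy) m.cast_nonneg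
      refine (((hasDerivAt_const y (1 : ℝ)).div ((hasDerivAt_id y).add_const (m : ℝ))
        hy'.ne').const_sub _).congr_deriv ?_
      simp [neg_div])
    (fun m y hy => by
      have hy' : x / 2 < y := hy
      rw [Real.norm_of_nonneg (by positivity)]
      gcongr)
    (mem_Ioi.2 (by linarith)) (hasSum_realDigamma_sub hδ (by linarith)).summable
    (mem_Ioi.2 (by linarith))
  refine (h.add_const (realDigamma (x / 2))).congr_of_eventuallyEq ?_
  filter_upwards [lt_mem_nhds (by linarith : x / 2 < x)] with y hy
  rw [(hasSum_realDigamma_sub hδ hy.le).tsum_eq]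
  ring

lemma abs_two_div_cube_le {δ x : ℝ} (hδ : 0 < δ) (h : δ ≤ x) (m : ℕ) :
    |-2 / (x + m) ^ 3| ≤ 2 / δ * (1 / (δ + m) ^ 2) := by
  have hx : 0 < x := hδ.trans_le h
  rw [neg_div, abs_neg, abs_of_pos (by positivity),
    show 2 / (x + m) ^ 3 = 2 / (x + m) * (1 / (x + m) ^ 2) by field_simp]
  gcongr
  linarith [(m.cast_nonneg : (0 : ℝ) ≤ m)]

lemma hasDerivAt_trigamma {x : ℝ} (hx : 0 < x) : HasDerivAt trigamma (tetragamma x) x := by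
  have hδ : 0 < x / 2 := by positivity
  exact hasDerivAt_tsum_of_isPreconnected (t := Ioi (x / 2)) (y := x) (y₀ := x)
    (g := fun (m : ℕ) (y : ℝ) => 1 / (y + m) ^ 2) (g' := fun (m : ℕ) (y : ℝ) => -2 / (y + m) ^ 3)
    ((summable_one_div_add_sq hδ).mul_left (2 / (x / 2))) isOpen_Ioi isPreconnected_Ioi
    (fun m y hy => by
      have hy' : 0 < y + m := add_pos_of_pos_of_nonneg (hδ.trans hy) m.cast_nonneg
      refine ((hasDerivAt_const y (1 : ℝ)).div (((hasDerivAt_id y).add_const (m : ℝ)).pow 2)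
        (pow_ne_zero 2 hy'.ne')).congr_deriv ?_
      simp
      field_simp)
    (fun m y hy => abs_two_div_cube_le hδ (le_of_lt hy) m)
    (mem_Ioi.2 (by linarith)) (summable_one_div_add_sq hx) (mem_Ioi.2 (by linarith))

lemma trigamma_pos {x : ℝ} (hx : 0 < x) : 0 < trigamma x :=
  (summable_one_div_add_sq hx).tsum_pos (fun m => by positivity) 0 (by simp; positivity)

lemma trigamma_le {x : ℝ} (hx : 0 < x) : trigamma x ≤ 1 / x ^ 2 + 1 / x := by
  refine Real.tsum_le_of_sum_range_le (fun m => by positivity) fun n => ?_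
  have h : ∀ n : ℕ, ∑ m ∈ Finset.range (n + 1), 1 / (x + m) ^ 2 ≤
      1 / x ^ 2 + 1 / x - 1 / (x + n) := by
    intro n
    induction n with
    | zero => simp
    | succ n ih =>
      rw [Finset.sum_range_succ]
      have h1 : 1 / (x + (n + 1 : ℕ)) ^ 2 ≤ 1 / (x + n) - 1 / (x + (n + 1 : ℕ)) := by
        push_cast
        rw [div_sub_div _ _ (by positivity) (by positivity),
          div_le_div_iff₀ (by positivity) (by positivity)]
        have h0 : (0 : ℝ) ≤ n := n.cast_nonneg
        nlinarith
      linarith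
  have h1 : ∑ m ∈ Finset.range n, 1 / (x + m) ^ 2 ≤
      ∑ m ∈ Finset.range (n + 1), 1 / (x + m) ^ 2 := by
    rw [Finset.sum_range_succ]
    exact le_add_of_nonneg_right (by positivity)
  have h2 : 0 ≤ 1 / (x + n) := by positivity
  linarith [h n]

/-- Termwise, `2 x / (x + m) ^ 3 ≤ 2 / (x + m) ^ 2`. -/
lemma abs_mul_tetragamma_le {x : ℝ} (hx : 0 < x) : |x * tetragamma x| ≤ 2 * |trigamma x| := by
  rw [abs_of_pos (trigamma_pos hx), tetragamma, trigamma, ← tsum_mul_left, ← tsum_mul_left]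
  rw [← Real.norm_eq_abs]
  refine tsum_of_norm_bounded ((summable_one_div_add_sq hx).mul_left 2).hasSum fun m => ?_
  have h0 : (0 : ℝ) ≤ m := m.cast_nonneg
  rw [Real.norm_eq_abs, abs_mul, neg_div, abs_neg, abs_of_pos hx, abs_of_pos (by positivity),
    show x * (2 / (x + m) ^ 3) = 2 * (x / (x + m) * (1 / (x + m) ^ 2)) by field_simp]
  refine mul_le_mul_of_nonneg_left (mul_le_of_le_one_left (by positivity) ?_) zero_le_two
  rw [div_le_one (by positivity)]
  linarith

theorem amenableWith_realDigamma :
    AmenableWith realDigamma (Ioi 0) (fun x => x * deriv realDigamma x / realDigamma x) 1 := by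
  refine amenableWith_of_hasDerivAt (f' := trigamma) (f'' := tetragamma) isOpen_Ioi zero_le_one
    (fun x hx => hasDerivAt_realDigamma hx) (fun x hx => hasDerivAt_trigamma hx) ?_
    (fun x hx _ _ => (trigamma_pos hx).ne') boundary_Ioi_zero
    (fun x hx _ _ => abs_le_of_abs_mul_le_two_mul (abs_mul_tetragamma_le hx))
  intro x hx _ _
  rw [(hasDerivAt_realDigamma hx).deriv]

lemma one_third_le_realDigamma {x : ℝ} (hx : 2 ≤ x) : 1 / 3 ≤ realDigamma x := by
  have h1 : realDigamma 1 = -Real.eulerMascheroniConstant := by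
    rw [realDigamma, logDeriv_apply, Real.hasDerivAt_Gamma_one.deriv, Real.Gamma_one, div_one]
  have h2 := realDigamma_add_one one_pos
  have h3 := realDigamma_monotoneOn (mem_Ioi.2 (by norm_num : (0 : ℝ) < 1 + 1))
    (mem_Ioi.2 (by linarith)) (by linarith : 1 + 1 ≤ x)
  rw [h2, h1] at h3
  linarith [Real.eulerMascheroniConstant_lt_two_thirds]

/-- The bound on `H` for `Γ`: as `x² ψ' ≤ x + 1`, it is clear for `x ≤ 2`, and for `x ≥ 2` the term
with `ψ²` takes over because `ψ ≥ 1/3` there. -/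
lemma sq_mul_trigamma_le {x : ℝ} (hx : 0 < x) :
    x ^ 2 * trigamma x ≤ 3 + 2 * (x ^ 2 * realDigamma x ^ 2) := by
  have h1 : x ^ 2 * trigamma x ≤ x + 1 := by
    calc x ^ 2 * trigamma x ≤ x ^ 2 * (1 / x ^ 2 + 1 / x) :=
          mul_le_mul_of_nonneg_left (trigamma_le hx) (sq_nonneg x)
      _ = x + 1 := by field_simp; ring
  have h2 : 0 ≤ x ^ 2 * realDigamma x ^ 2 := by positivity
  rcases le_total x 2 with h | h
  · linarith
  · have h3 : (1 / 3) ^ 2 ≤ realDigamma x ^ 2 :=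
      pow_le_pow_left₀ (by norm_num) (one_third_le_realDigamma h) 2
    have h4 := mul_le_mul_of_nonneg_left h3 (sq_nonneg x)
    nlinarith [sq_nonneg (x - 3)]

theorem amenableWith_Gamma :
    AmenableWith Real.Gamma (Ioi 0) (fun x => x * realDigamma x) 3 := by
  refine amenableWith_of_hasDerivAt (f' := fun x => Real.Gamma x * realDigamma x)
    (f'' := fun x => Real.Gamma x * realDigamma x * realDigamma x + Real.Gamma x * trigamma x)
    isOpen_Ioi (by norm_num)
    (fun x hx => hasDerivAt_Gamma_of_pos hx)
    (fun x hx => (hasDerivAt_Gamma_of_pos hx).mul (hasDerivAt_realDigamma hx)) ?_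
    (fun x hx _ h => absurd h (Real.Gamma_pos_of_pos hx).ne') boundary_Ioi_zero ?_
  · intro x _ _ h
    congr 1
    field_simp
  · intro x hx _ _
    have hx0 : 0 < x := hx
    have hψ := trigamma_pos hx0
    rw [show x ^ 2 * Real.Gamma x *
        (Real.Gamma x * realDigamma x * realDigamma x + Real.Gamma x * trigamma x) =
        Real.Gamma x ^ 2 * (x ^ 2 * trigamma x + x ^ 2 * realDigamma x ^ 2) by ring,
      abs_of_nonneg (by positivity),
      show 3 * (Real.Gamma x ^ 2 + x ^ 2 * (Real.Gamma x * realDigamma x) ^ 2) =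
        Real.Gamma x ^ 2 * (3 + 3 * (x ^ 2 * realDigamma x ^ 2)) by ring]
    refine mul_le_mul_of_nonneg_left ?_ (sq_nonneg _)
    linarith [sq_mul_trigamma_le hx0]

/-! ### Local bounds on `H` for meromorphic functions -/

lemma abs_hQuot_le_of_abs_sq_mul_le {f : ℝ → ℝ} {x B : ℝ} (hB : 0 ≤ B)
    (h : |x ^ 2 * deriv (deriv f) x| ≤ B * |f x|) : |hQuot f x| ≤ B := by
  refine abs_hQuot_le hB ?_
  have h1 := mul_le_mul_of_nonneg_right h (abs_nonneg (f x))
  rw [← abs_mul, mul_assoc B, ← abs_mul, ← sq, abs_of_nonneg (sq_nonneg (f x))] at h1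
  rw [show x ^ 2 * f x * deriv (deriv f) x = x ^ 2 * deriv (deriv f) x * f x by ring]
  nlinarith [mul_nonneg hB (by positivity : 0 ≤ x ^ 2 * deriv f x ^ 2)]

lemma exists_eventually_abs_le_mul_abs {u v : ℝ → ℝ} {a : ℝ} (hu : ContinuousAt u a)
    (hv : ContinuousAt v a) (hva : v a ≠ 0) :
    ∃ M : ℝ, 0 ≤ M ∧ ∀ᶠ x in 𝓝 a, |u x| ≤ M * |v x| := by
  refine ⟨|u a / v a| + 1, by positivity, ?_⟩
  filter_upwards [(hu.div hv hva).abs.eventually (gt_mem_nhds (lt_add_one _)),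
    hv.eventually_ne hva] with x hx hvx
  rw [Pi.div_apply, abs_div, div_lt_iff₀ (abs_pos.2 hvx)] at hx
  exact hx.le

/-- Differentiating lowers the exponent in a local expression `(z - a) ^ n * g z` by one, and
multiplies the leading coefficient by `n`. -/
lemma deriv_eventuallyEq_zpow_mul {f g : ℝ → ℝ} {a : ℝ} {n : ℤ} (hg : AnalyticAt ℝ g a)
    (h : ∀ᶠ z in 𝓝[≠] a, f z = (z - a) ^ n * g z) :
    ∃ g₁ : ℝ → ℝ, AnalyticAt ℝ g₁ a ∧ g₁ a = n * g a ∧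
      ∀ᶠ z in 𝓝[≠] a, deriv f z = (z - a) ^ (n - 1) * g₁ z := by
  refine ⟨fun z => n * g z + (z - a) * deriv g z, ?_, by simp, ?_⟩
  · have := hg.deriv
    fun_prop
  · filter_upwards [eventually_eventually_nhdsWithin.2 h, self_mem_nhdsWithin,
      nhdsWithin_le_nhds hg.eventually_analyticAt] with z hz hza hgz
    have hza' : z - a ≠ 0 := sub_ne_zero.2 hza
    rw [IsOpen.nhdsWithin_eq isOpen_compl_singleton hza] at hz
    have h1 : HasDerivAt (fun z => (z - a) ^ n) (n * (z - a) ^ (n - 1)) z := by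
      simpa using (hasDerivAt_zpow n (z - a) (Or.inl hza')).comp_sub_const z a
    rw [((h1.mul hgz.differentiableAt.hasDerivAt).congr_of_eventuallyEq hz).deriv]
    have h2 : (z - a) ^ n = (z - a) ^ (n - 1) * (z - a) := by
      rw [← zpow_add_one₀ hza', sub_add_cancel]
    rw [h2]
    ring

/-- Near a zero or a pole `a` of order `n ≠ 0` one has `f = O((x - a) f')` and `(x - a) f'' = O(f')`,
and otherwise `f'' = O(f)`. In both cases `H` is bounded. -/
lemma MeromorphicAt.exists_abs_hQuot_le {f : ℝ → ℝ} {a : ℝ} (hf : MeromorphicAt f a) :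
    ∃ B : ℝ, ∀ᶠ x in 𝓝[≠] a, |hQuot f x| ≤ B := by
  rcases eq_or_ne (meromorphicOrderAt f a) ⊤ with htop | htop
  · refine ⟨0, ?_⟩
    filter_upwards [meromorphicOrderAt_eq_top_iff.1 htop] with x hx
    simp [hQuot, hx]
  lift meromorphicOrderAt f a to ℤ using htop with n hn
  obtain ⟨g, hg, hga, hfg⟩ := (meromorphicOrderAt_eq_int_iff hf).1 hn.symm
  simp only [smul_eq_mul] at hfg
  rcases eq_or_ne n 0 with rfl | hn0
  · simp only [zpow_zero, one_mul] at hfg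
    obtain ⟨M, hM, hbound⟩ := exists_eventually_abs_le_mul_abs (a := a)
      (u := fun x => x ^ 2 * deriv (deriv g) x) (v := g)
      (by have := hg.deriv.deriv.continuousAt; fun_prop) hg.continuousAt hga
    refine ⟨M, ?_⟩
    filter_upwards [eventually_eventually_nhdsWithin.2 hfg, self_mem_nhdsWithin,
      nhdsWithin_le_nhds hbound] with x hx hxa hb
    rw [IsOpen.nhdsWithin_eq isOpen_compl_singleton hxa] at hx
    have hx' : f =ᶠ[𝓝 x] g := hx
    refine abs_hQuot_le_of_abs_sq_mul_le hM ?_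
    rwa [hx'.deriv.deriv_eq, hx'.eq_of_nhds]
  · obtain ⟨g₁, hg₁, hg₁a, hfg₁⟩ := deriv_eventuallyEq_zpow_mul hg hfg
    obtain ⟨g₂, hg₂, _, hfg₂⟩ := deriv_eventuallyEq_zpow_mul hg₁ hfg₁
    have hne : g₁ a ≠ 0 := by rw [hg₁a]; exact mul_ne_zero (by exact_mod_cast hn0) hga
    obtain ⟨M, hM, hb⟩ := exists_eventually_abs_le_mul_abs hg.continuousAt hg₁.continuousAt hne
    obtain ⟨N, hN, hb₂⟩ := exists_eventually_abs_le_mul_abs hg₂.continuousAt hg₁.continuousAt hne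
    refine ⟨M * N, ?_⟩
    filter_upwards [hfg, hfg₁, hfg₂, self_mem_nhdsWithin, nhdsWithin_le_nhds hb,
      nhdsWithin_le_nhds hb₂] with x hx hx₁ hx₂ hxa hb hb₂
    have hxa' : x - a ≠ 0 := sub_ne_zero.2 hxa
    refine abs_hQuot_le (mul_nonneg hM hN) ?_
    have h1 : (x - a) ^ n * (x - a) ^ (n - 1 - 1) = ((x - a) ^ (n - 1)) ^ 2 := by
      rw [← zpow_add₀ hxa', sq, ← zpow_add₀ hxa']
      congr 1
      ring
    have h2 : |x ^ 2 * f x * deriv (deriv f) x| =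
        x ^ 2 * ((x - a) ^ (n - 1)) ^ 2 * (|g x| * |g₂ x|) := by
      rw [hx, hx₂, show x ^ 2 * ((x - a) ^ n * g x) * ((x - a) ^ (n - 1 - 1) * g₂ x) =
        x ^ 2 * ((x - a) ^ n * (x - a) ^ (n - 1 - 1)) * (g x * g₂ x) by ring, h1, abs_mul,
        abs_of_nonneg (by positivity), abs_mul]
    have h3 : |g x| * |g₂ x| ≤ M * N * g₁ x ^ 2 := by
      rw [← sq_abs (g₁ x)]
      calc |g x| * |g₂ x| ≤ (M * |g₁ x|) * (N * |g₁ x|) := by gcongr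
        _ = M * N * |g₁ x| ^ 2 := by ring
    have h4 : x ^ 2 * ((x - a) ^ (n - 1)) ^ 2 * (|g x| * |g₂ x|) ≤
        x ^ 2 * ((x - a) ^ (n - 1)) ^ 2 * (M * N * g₁ x ^ 2) :=
      mul_le_mul_of_nonneg_left h3 (by positivity)
    rw [h2]
    refine h4.trans ?_
    rw [hx₁, mul_pow]
    nlinarith [mul_nonneg (mul_nonneg hM hN) (sq_nonneg (f x))]

lemma exists_abs_hQuot_le_of_isCompact {f : ℝ → ℝ} {K : Set ℝ} (hK : IsCompact K)
    (hf : ∀ a ∈ K, MeromorphicAt f a) : ∃ B : ℝ, ∀ x ∈ K, |hQuot f x| ≤ B := by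
  refine hK.induction_on (p := fun s => ∃ B : ℝ, ∀ x ∈ s, |hQuot f x| ≤ B) ⟨0, by simp⟩ ?_ ?_ ?_
  · rintro s t hst ⟨B, hB⟩
    exact ⟨B, fun x hx => hB x (hst hx)⟩
  · rintro s t ⟨B, hB⟩ ⟨C, hC⟩
    refine ⟨max B C, ?_⟩
    rintro x (hx | hx)
    · exact (hB x hx).trans (le_max_left _ _)
    · exact (hC x hx).trans (le_max_right _ _)
  · intro a ha
    obtain ⟨B, hB⟩ := (hf a ha).exists_abs_hQuot_le
    refine ⟨{x | |hQuot f x| ≤ max B |hQuot f a|}, nhdsWithin_le_nhds ?_, _, fun x hx => hx⟩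
    filter_upwards [eventually_nhdsWithin_iff.1 hB] with x hx
    by_cases h : x = a
    · rw [h]
      exact le_max_right _ _
    · exact (hx h).trans (le_max_left _ _)

/-! ### Polynomials and rational functions -/

open Polynomial in
lemma degree_X_mul_derivative_le (p : Polynomial ℝ) : (X * derivative p).degree ≤ p.degree := by
  rcases eq_or_ne (derivative p) 0 with h | h
  · simp [h]
  have hp : p ≠ 0 := by rintro rfl; simp at h
  have hnat := natDegree_derivative_lt (p := p) (fun h0 => h (derivative_of_natDegree_zero h0))
  rw [degree_eq_natDegree (mul_ne_zero X_ne_zero h), degree_eq_natDegree hp, natDegree_X_mul h]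
  exact_mod_cast hnat

open Polynomial in
/-- The numerator of the derivative of `p / q`, over the denominator `q ^ 2`. -/
noncomputable def derivNum (p q : Polynomial ℝ) : Polynomial ℝ :=
  derivative p * q - p * derivative q

open Polynomial in
lemma degree_X_mul_derivNum_le (p q : Polynomial ℝ) :
    (X * derivNum p q).degree ≤ p.degree + q.degree := by
  rw [derivNum, show X * (derivative p * q - p * derivative q) =
    X * derivative p * q - p * (X * derivative q) by ring]
  refine (degree_sub_le _ _).trans (max_le ?_ ?_)
  · rw [degree_mul]
    exact add_le_add_left (degree_X_mul_derivative_le p) _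
  · rw [degree_mul]
    exact add_le_add_right (degree_X_mul_derivative_le q) _

open Polynomial in
lemma degree_X_sq_mul_derivNum_derivNum_le (p q : Polynomial ℝ) :
    (X ^ 2 * derivNum (derivNum p q) (q ^ 2)).degree ≤ (p * q ^ 3).degree := by
  set p₁ := derivNum p q with hp₁
  have h1 : (X * p₁).degree ≤ p.degree + q.degree := degree_X_mul_derivNum_le p q
  rw [derivNum, show X ^ 2 * (derivative p₁ * q ^ 2 - p₁ * derivative (q ^ 2)) =
    X * (X * derivative p₁) * q ^ 2 - (X * p₁) * (X * derivative (q ^ 2)) by ring,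
    show p * q ^ 3 = p * q * q ^ 2 by ring]
  refine (degree_sub_le _ _).trans (max_le ?_ ?_)
  · rw [degree_mul, degree_mul (p := p * q), degree_mul (p := p)]
    refine add_le_add_left (le_trans ?_ h1) _
    rw [degree_mul (p := X) (q := X * derivative p₁), degree_mul (p := X) (q := p₁)]
    exact add_le_add_right (degree_X_mul_derivative_le p₁) _
  · rw [degree_mul, degree_mul (p := p * q), degree_mul (p := p)]
    exact add_le_add h1 (degree_X_mul_derivative_le _)

lemma hasDerivAt_eval_div_eval (p q : Polynomial ℝ) {x : ℝ} (hq : q.eval x ≠ 0) :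
    HasDerivAt (fun x => p.eval x / q.eval x) ((derivNum p q).eval x / (q ^ 2).eval x) x := by
  refine ((p.hasDerivAt x).div (q.hasDerivAt x) hq).congr_deriv ?_
  simp [derivNum]

lemma isOpen_eval_ne_zero (q : Polynomial ℝ) : IsOpen {x | q.eval x ≠ 0} :=
  isOpen_ne.preimage q.continuous

lemma hasDerivAt_deriv_eval_div_eval (p q : Polynomial ℝ) {x : ℝ} (hq : q.eval x ≠ 0) :
    HasDerivAt (deriv fun x => p.eval x / q.eval x)
      ((derivNum (derivNum p q) (q ^ 2)).eval x / ((q ^ 2) ^ 2).eval x) x := by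
  refine (hasDerivAt_eval_div_eval (derivNum p q) (q ^ 2)
    (by simpa using hq)).congr_of_eventuallyEq ?_
  filter_upwards [(isOpen_eval_ne_zero q).mem_nhds hq] with y hy
    using (hasDerivAt_eval_div_eval p q hy).deriv

/-- Transfer of `x² f'' = O(f)` to a bound on `H` for a rational function `f`, along `l = ±∞`. -/
lemma exists_eventually_abs_hQuot_le_of_isBigO {p q : Polynomial ℝ} {l : Filter ℝ}
    (hq : ∀ᶠ x in l, q.eval x ≠ 0)
    (h : (fun x => (Polynomial.X ^ 2 * derivNum (derivNum p q) (q ^ 2)).eval x) =O[l]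
      fun x => (p * q ^ 3).eval x) :
    ∃ B : ℝ, ∀ᶠ x in l, |hQuot (fun x => p.eval x / q.eval x) x| ≤ B := by
  obtain ⟨M, hM, hb⟩ := h.exists_nonneg
  refine ⟨M, ?_⟩
  filter_upwards [hq, hb.bound] with x hqx hx
  refine abs_hQuot_le_of_abs_sq_mul_le hM ?_
  rw [(hasDerivAt_deriv_eval_div_eval p q hqx).deriv]
  simp only [Polynomial.eval_mul, Polynomial.eval_pow, Polynomial.eval_X, Real.norm_eq_abs] at hx ⊢
  rw [← mul_div_assoc, abs_div, div_le_iff₀ (abs_pos.2 (by positivity)), mul_assoc, ← abs_mul,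
    show p.eval x / q.eval x * (q.eval x ^ 2) ^ 2 = p.eval x * q.eval x ^ 3 by field_simp]
  exact hx

lemma exists_abs_hQuot_rational_le (p q : Polynomial ℝ) (hq : q ≠ 0) :
    ∃ B : ℝ, ∀ x : ℝ, |hQuot (fun x => p.eval x / q.eval x) x| ≤ B := by
  have hroots : {x : ℝ | q.eval x = 0}.Finite := q.finite_setOfPred_isRoot hq
  have hdeg := degree_X_sq_mul_derivNum_derivNum_le p q
  have htop : ∀ᶠ x in atTop, q.eval x ≠ 0 := atTop_le_cofinite hroots.compl_mem_cofinite
  have hbot : ∀ᶠ x in atBot, q.eval x ≠ 0 := atBot_le_cofinite hroots.compl_mem_cofinite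
  obtain ⟨B₁, h₁⟩ := exists_eventually_abs_hQuot_le_of_isBigO htop
    (Polynomial.isBigO_atTop_of_degree_le _ _ hdeg)
  obtain ⟨B₂, h₂⟩ := exists_eventually_abs_hQuot_le_of_isBigO hbot
    (Polynomial.isBigO_atBot_of_degree_le _ _ hdeg)
  obtain ⟨R₁, hR₁⟩ := eventually_atTop.1 h₁
  obtain ⟨R₂, hR₂⟩ := eventually_atBot.1 h₂
  obtain ⟨B₃, h₃⟩ := exists_abs_hQuot_le_of_isCompact (f := fun x => p.eval x / q.eval x)
    (isCompact_Icc (a := R₂) (b := R₁)) fun a _ =>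
      (AnalyticOnNhd.eval_polynomial p a (mem_univ a)).meromorphicAt.fun_div
        (AnalyticOnNhd.eval_polynomial q a (mem_univ a)).meromorphicAt
  refine ⟨max B₁ (max B₂ B₃), fun x => ?_⟩
  rcases le_total R₁ x with h | h
  · exact (hR₁ x h).trans (le_max_left _ _)
  rcases le_total x R₂ with h' | h'
  · exact (hR₂ x h').trans ((le_max_left _ _).trans (le_max_right _ _))
  · exact (h₃ x ⟨h', h⟩).trans ((le_max_right _ _).trans (le_max_right _ _))

lemma eventually_eval_ne_zero {p : Polynomial ℝ} (hp : p ≠ 0) (x : ℝ) :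
    ∀ᶠ y in 𝓝[≠] x, p.eval y ≠ 0 := by
  have hfin : {y : ℝ | p.eval y = 0}.Finite := p.finite_setOfPred_isRoot hp
  filter_upwards [nhdsWithin_le_nhds ((hfin.sdiff (t := {x})).isClosed.isOpen_compl.mem_nhds
    (by simp)), self_mem_nhdsWithin] with y hy hyx h
  exact hy ⟨h, hyx⟩

theorem condFormula_rational {p q : Polynomial ℝ} (hp : p ≠ 0) (hq : q ≠ 0) :
    CondFormula (fun x => p.eval x / q.eval x) {x | q.eval x ≠ 0}
      (fun x => x * deriv (fun t => p.eval t / q.eval t) x / (p.eval x / q.eval x)) := by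
  refine condFormula_of_differentiable (isOpen_eval_ne_zero q)
    (fun x hx => (hasDerivAt_eval_div_eval p q hx).differentiableAt) (fun _ _ _ _ => rfl) ?_
  intro x _ _ _
  refine Frequently.filter_mono (Eventually.frequently ?_) (nhdsWithin_le_nhds (s := {x}ᶜ))
  filter_upwards [eventually_eval_ne_zero hp x, eventually_eval_ne_zero hq x] with y h1 h2
    using div_ne_zero h1 h2

theorem amenable_rational {p q : Polynomial ℝ} (hq : q ≠ 0) (hpq : IsCoprime p q) :
    Amenable (fun x => p.eval x / q.eval x) {x | q.eval x ≠ 0} := by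
  have hcop : ∀ x, q.eval x = 0 → p.eval x ≠ 0 := by
    intro x h1 h2
    obtain ⟨a, b, h⟩ := hpq
    have := congrArg (Polynomial.eval x) h
    simp [h1, h2] at this
  rcases eq_or_ne p 0 with rfl | hp
  · -- The fraction is in lowest terms, so the denominator of the zero function has no zeros.
    exact amenable_of_eq_zero (by simp) fun _ _ y _ hy => hcop y hy (by simp)
  obtain ⟨B, hB⟩ := exists_abs_hQuot_rational_le p q hq
  refine amenable_of_hQuot_le (isOpen_eval_ne_zero q)
    (fun x hx => (hasDerivAt_eval_div_eval p q hx).differentiableAt)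
    (fun x hx => (hasDerivAt_deriv_eval_div_eval p q hx).differentiableAt)
    (condFormula_rational hp hq) ?_ (fun x _ => hB x)
  intro s _ hs _
  have hqs : q.eval s = 0 := not_not.1 hs
  have hps := hcop s hqs
  have h1 : Tendsto (fun x => q.eval x / p.eval x) (𝓝[{x | q.eval x ≠ 0}] s) (𝓝[≠] 0) := by
    refine tendsto_nhdsWithin_iff.2 ⟨?_, ?_⟩
    · have : ContinuousAt (fun x => q.eval x / p.eval x) s :=
        q.continuousAt.div p.continuousAt hps
      rw [ContinuousAt, hqs, zero_div] at this
      exact this.mono_left nhdsWithin_le_nhds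
    · filter_upwards [self_mem_nhdsWithin,
        nhdsWithin_le_nhds ((isOpen_eval_ne_zero p).mem_nhds hps)] with x h1 h2
        using div_ne_zero h1 h2
  refine (tendsto_abs_atBot_atTop.comp (Real.tendsto_log_nhdsNE_zero.comp h1)).congr fun x => ?_
  simp only [Function.comp_apply]
  rw [← inv_div, Real.log_inv, abs_neg]

theorem amenable_and_condFormula_and_hQuot_le_polynomial (p : Polynomial ℝ) :
    Amenable (fun x => p.eval x) univ ∧
      (p ≠ 0 → CondFormula (fun x => p.eval x) univ
        (fun x => x * p.derivative.eval x / p.eval x)) ∧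
      ∃ B : ℝ, ∀ x : ℝ, |hQuot (fun x => p.eval x) x| ≤ B := by
  have hfun : (fun x => p.eval x / (1 : Polynomial ℝ).eval x) = fun x => p.eval x := by
    simp
  have hset : {x : ℝ | (1 : Polynomial ℝ).eval x ≠ 0} = univ := by simp
  refine ⟨?_, fun hp => ?_, ?_⟩
  · have := amenable_rational (p := p) one_ne_zero isCoprime_one_right
    rwa [hfun, hset] at this
  · have := condFormula_rational hp one_ne_zero
    rw [hset] at this
    simpa using this
  · have := exists_abs_hQuot_rational_le p 1 one_ne_zero
    rwa [hfun] at this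

/-! ### Sums of real powers -/

section RealPowers

variable {k : ℕ}

/-- Weighting the terms of a sum of powers by a function of the exponent changes it at `+∞` by at most
a constant factor, since it is governed there by the largest exponent whose total coefficient does not
vanish. -/
lemma exists_eventually_atTop_abs_sum_rpow_le (a α : Fin k → ℝ) (w : ℝ → ℝ) :
    ∃ M : ℝ, 0 ≤ M ∧ ∀ᶠ x : ℝ in atTop,
      |∑ i, a i * w (α i) * x ^ α i| ≤ M * |∑ i, a i * x ^ α i| := by
  classical
  -- Equal exponents are grouped together, and those with total coefficient zero are dropped.
  let c : ℝ → ℝ := fun β => ∑ i with α i = β, a i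
  let T : Finset ℝ := {β ∈ Finset.univ.image α | c β ≠ 0}
  have hsum : ∀ (v : ℝ → ℝ) (x : ℝ), ∑ i, a i * v (α i) * x ^ α i = ∑ β ∈ T, c β * v β * x ^ β := by
    intro v x
    have hT : ∑ β ∈ T, c β * v β * x ^ β = ∑ β ∈ Finset.univ.image α, c β * v β * x ^ β :=
      Finset.sum_filter_of_ne fun β _ h h0 => h (by rw [h0]; ring)
    rw [hT, ← Finset.sum_fiberwise_of_maps_to (t := Finset.univ.image α) (g := α) (by simp)]
    refine Finset.sum_congr rfl fun β _ => ?_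
    rw [Finset.sum_mul, Finset.sum_mul]
    refine Finset.sum_congr rfl fun i hi => ?_
    rw [(Finset.mem_filter.1 hi).2]
  have hsum₁ : ∀ x : ℝ, ∑ i, a i * x ^ α i = ∑ β ∈ T, c β * 1 * x ^ β := by
    intro x
    rw [← hsum (fun _ => 1) x]
    simp
  rcases T.eq_empty_or_nonempty with hT | hT
  · refine ⟨0, le_rfl, Eventually.of_forall fun x => ?_⟩
    rw [hsum w, hT]
    simp
  set β₀ := T.max' hT with hβ₀
  have hβT : β₀ ∈ T := T.max'_mem hT
  have hc : c β₀ ≠ 0 := (Finset.mem_filter.1 hβT).2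
  have hlim : ∀ v : ℝ → ℝ, Tendsto (fun x : ℝ => ∑ β ∈ T, c β * v β * x ^ (β - β₀)) atTop
      (𝓝 (c β₀ * v β₀)) := by
    intro v
    have h : ∀ β ∈ T, Tendsto (fun x : ℝ => c β * v β * x ^ (β - β₀)) atTop
        (𝓝 (if β = β₀ then c β₀ * v β₀ else 0)) := by
      intro β hβ
      split_ifs with h
      · simp [h]
      · have hlt : 0 < β₀ - β := sub_pos.2 (lt_of_le_of_ne (T.le_max' β hβ) h)
        simpa using (tendsto_rpow_neg_atTop hlt).const_mul (c β * v β)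
    have := tendsto_finsetSum T h
    rwa [Finset.sum_ite_eq' T β₀, if_pos hβT] at this
  have hdiv : ∀ᶠ x : ℝ in atTop, |∑ β ∈ T, c β * w β * x ^ (β - β₀)| ≤
      (|c β₀ * w β₀ / (c β₀ * 1)| + 1) * |∑ β ∈ T, c β * 1 * x ^ (β - β₀)| := by
    have h1 := hlim fun _ => 1
    filter_upwards [((hlim w).div h1 (by simpa using hc)).abs.eventually
      (gt_mem_nhds (lt_add_one _)), h1.eventually_ne (by simpa using hc)] with x hx hne
    rw [Pi.div_apply, abs_div, div_lt_iff₀ (abs_pos.2 hne)] at hx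
    exact hx.le
  refine ⟨|c β₀ * w β₀ / (c β₀ * 1)| + 1, by positivity, ?_⟩
  filter_upwards [hdiv, eventually_gt_atTop 0] with x hx hx0
  have hscale : ∀ v : ℝ → ℝ, ∑ β ∈ T, c β * v β * x ^ β =
      x ^ β₀ * ∑ β ∈ T, c β * v β * x ^ (β - β₀) := by
    intro v
    rw [Finset.mul_sum]
    refine Finset.sum_congr rfl fun β _ => ?_
    rw [Real.rpow_sub hx0]
    have := (Real.rpow_pos_of_pos hx0 β₀).ne'
    field_simp
  rw [hsum, hsum₁, hscale w, hscale fun _ => 1, abs_mul, abs_mul]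
  calc _ ≤ |x ^ β₀| * ((|c β₀ * w β₀ / (c β₀ * 1)| + 1) *
          |∑ β ∈ T, c β * 1 * x ^ (β - β₀)|) :=
        mul_le_mul_of_nonneg_left hx (abs_nonneg _)
    _ = _ := by ring

/-- The substitution `x ↦ 1 / x` carries the behaviour at `+∞` over to `0`. -/
lemma exists_eventually_nhdsGT_abs_sum_rpow_le (a α : Fin k → ℝ) (w : ℝ → ℝ) :
    ∃ M : ℝ, 0 ≤ M ∧ ∀ᶠ x : ℝ in 𝓝[>] 0,
      |∑ i, a i * w (α i) * x ^ α i| ≤ M * |∑ i, a i * x ^ α i| := by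
  obtain ⟨M, hM, h⟩ := exists_eventually_atTop_abs_sum_rpow_le a (fun i => -α i) (fun β => w (-β))
  refine ⟨M, hM, ?_⟩
  filter_upwards [tendsto_inv_nhdsGT_zero.eventually h, self_mem_nhdsWithin] with x hx hx0
  have hx0' : (0 : ℝ) ≤ x := le_of_lt hx0
  simpa only [neg_neg, Real.inv_rpow hx0', Real.rpow_neg hx0', inv_inv] using hx

lemma hasDerivAt_sum_rpow (a α : Fin k → ℝ) {x : ℝ} (hx : 0 < x) :
    HasDerivAt (fun x : ℝ => ∑ i, a i * x ^ α i) (∑ i, a i * α i * x ^ (α i - 1)) x := by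
  refine HasDerivAt.fun_sum fun i _ => ?_
  refine ((Real.hasDerivAt_rpow_const (Or.inl hx.ne')).const_mul (a i)).congr_deriv ?_
  ring

lemma hasDerivAt_deriv_sum_rpow (a α : Fin k → ℝ) {x : ℝ} (hx : 0 < x) :
    HasDerivAt (deriv fun x : ℝ => ∑ i, a i * x ^ α i)
      (∑ i, a i * α i * (α i - 1) * x ^ (α i - 1 - 1)) x := by
  refine (hasDerivAt_sum_rpow (fun i => a i * α i) (fun i => α i - 1) hx).congr_of_eventuallyEq ?_
  filter_upwards [lt_mem_nhds hx] with y hy using (hasDerivAt_sum_rpow a α hy).deriv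

lemma sq_mul_deriv_deriv_sum_rpow (a α : Fin k → ℝ) {x : ℝ} (hx : 0 < x) :
    x ^ 2 * deriv (deriv fun x : ℝ => ∑ i, a i * x ^ α i) x =
      ∑ i, a i * (fun β => β * (β - 1)) (α i) * x ^ α i := by
  rw [(hasDerivAt_deriv_sum_rpow a α hx).deriv, Finset.mul_sum]
  refine Finset.sum_congr rfl fun i _ => ?_
  rw [Real.rpow_sub_one hx.ne', Real.rpow_sub_one hx.ne']
  field_simp

lemma analyticOnNhd_sum_rpow (a α : Fin k → ℝ) :
    AnalyticOnNhd ℝ (fun x : ℝ => ∑ i, a i * x ^ α i) (Ioi 0) := by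
  intro x hx
  have h : AnalyticAt ℝ (fun x : ℝ => ∑ i, a i * Real.exp (Real.log x * α i)) x := by
    refine Finset.analyticAt_fun_sum _ fun i _ => ?_
    exact analyticAt_const.mul (((analyticAt_log hx).mul analyticAt_const).rexp')
  refine h.congr ?_
  filter_upwards [lt_mem_nhds (mem_Ioi.1 hx)] with y hy
  exact Finset.sum_congr rfl fun i _ => by rw [Real.rpow_def_of_pos hy]

lemma exists_abs_hQuot_sum_rpow_le (a α : Fin k → ℝ) :
    ∃ B : ℝ, ∀ x : ℝ, 0 < x → |hQuot (fun x => ∑ i, a i * x ^ α i) x| ≤ B := by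
  obtain ⟨B₁, hB₁, h₁⟩ := exists_eventually_atTop_abs_sum_rpow_le a α (fun β => β * (β - 1))
  obtain ⟨B₂, hB₂, h₂⟩ := exists_eventually_nhdsGT_abs_sum_rpow_le a α (fun β => β * (β - 1))
  obtain ⟨R, hR⟩ := eventually_atTop.1 h₁
  obtain ⟨δ, hδ, hδ'⟩ := mem_nhdsGT_iff_exists_Ioc_subset.1 h₂
  have hδ0 : 0 < δ := hδ
  obtain ⟨B₃, h₃⟩ := exists_abs_hQuot_le_of_isCompact (f := fun x => ∑ i, a i * x ^ α i)
    (isCompact_Icc (a := δ) (b := R)) fun x hx =>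
      (analyticOnNhd_sum_rpow a α x (hδ0.trans_le hx.1)).meromorphicAt
  refine ⟨max B₁ (max B₂ B₃), fun x hx => ?_⟩
  rcases le_total R x with h | h
  · refine le_trans (abs_hQuot_le_of_abs_sq_mul_le hB₁ ?_) (le_max_left _ _)
    rw [sq_mul_deriv_deriv_sum_rpow a α hx]
    exact hR x h
  rcases le_total x δ with h' | h'
  · refine le_trans (abs_hQuot_le_of_abs_sq_mul_le hB₂ ?_)
      ((le_max_left _ _).trans (le_max_right _ _))
    rw [sq_mul_deriv_deriv_sum_rpow a α hx]
    exact hδ' ⟨hx, h'⟩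
  · exact (h₃ x ⟨h', h⟩).trans ((le_max_right _ _).trans (le_max_right _ _))

theorem condFormula_sum_rpow (a α : Fin k → ℝ) (h : ∃ x : ℝ, 0 < x ∧ ∑ i, a i * x ^ α i ≠ 0) :
    CondFormula (fun x => ∑ i, a i * x ^ α i) (Ioi 0)
      (fun x => x * deriv (fun t : ℝ => ∑ i, a i * t ^ α i) x / ∑ i, a i * x ^ α i) := by
  refine condFormula_of_differentiable isOpen_Ioi
    (fun x hx => (hasDerivAt_sum_rpow a α hx).differentiableAt) (fun _ _ _ _ => rfl) ?_
  intro x hx _ _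
  obtain ⟨y, hy, hne⟩ := h
  by_contra hcon
  simp only [not_frequently, not_not] at hcon
  exact hne ((analyticOnNhd_sum_rpow a α).eqOn_zero_of_preconnected_of_eventuallyEq_zero
    isPreconnected_Ioi hx hcon hy)

theorem amenable_sum_rpow (a α : Fin k → ℝ) :
    Amenable (fun x => ∑ i, a i * x ^ α i) (Ioi 0) := by
  by_cases h : ∃ x : ℝ, 0 < x ∧ ∑ i, a i * x ^ α i ≠ 0
  · obtain ⟨B, hB⟩ := exists_abs_hQuot_sum_rpow_le a α
    exact amenable_of_hQuot_le isOpen_Ioi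
      (fun x hx => (hasDerivAt_sum_rpow a α hx).differentiableAt)
      (fun x hx => (hasDerivAt_deriv_sum_rpow a α hx).differentiableAt)
      (condFormula_sum_rpow a α h) boundary_Ioi_zero hB
  · push Not at h
    exact amenable_of_eq_zero h fun x hx y hy => pos_of_mul_pos_left hy (le_of_lt hx)

end RealPowers

/-! ### The list of amenable functions -/

theorem mainTheorem11 :
    -- (1) polynomials
    (∀ p : Polynomial ℝ,
      Amenable (fun x => p.eval x) univ ∧
      (p ≠ 0 → CondFormula (fun x => p.eval x) univ
        (fun x => x * p.derivative.eval x / p.eval x)) ∧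
      ∃ B : ℝ, ∀ x : ℝ, |hQuot (fun x => p.eval x) x| ≤ B) ∧
    -- (2) rational functions, written as reduced fractions
    (∀ p q : Polynomial ℝ, q ≠ 0 → IsCoprime p q →
      Amenable (fun x => p.eval x / q.eval x) {x | q.eval x ≠ 0} ∧
      (p ≠ 0 → CondFormula (fun x => p.eval x / q.eval x) {x | q.eval x ≠ 0}
        (fun x => x * deriv (fun t => p.eval t / q.eval t) x / (p.eval x / q.eval x))) ∧
      ∃ B : ℝ, ∀ x : ℝ, q.eval x ≠ 0 → |hQuot (fun x => p.eval x / q.eval x) x| ≤ B) ∧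
    -- (3) sums of real powers
    (∀ (k : ℕ) (a α : Fin k → ℝ),
      Amenable (fun x => ∑ i, a i * x ^ α i) (Ioi 0) ∧
      ((∃ x : ℝ, 0 < x ∧ ∑ i, a i * x ^ α i ≠ 0) →
        CondFormula (fun x => ∑ i, a i * x ^ α i) (Ioi 0)
          (fun x => x * deriv (fun t : ℝ => ∑ i, a i * t ^ α i) x / ∑ i, a i * x ^ α i)) ∧
      ∃ B : ℝ, ∀ x : ℝ, 0 < x → |hQuot (fun x => ∑ i, a i * x ^ α i) x| ≤ B) ∧
    -- (4) sin
    (∀ k₁ k₂ : ℤ, k₁ ≤ k₂ →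
      AmenableWith Real.sin (Ioo (k₁ * Real.pi) (k₂ * Real.pi))
        (fun x => x * Real.cos x / Real.sin x)
        (((max |k₁| |k₂| : ℤ) : ℝ) ^ 2 * Real.pi ^ 2)) ∧
    -- (5) cos
    (∀ k₁ k₂ : ℤ, k₁ ≤ k₂ →
      AmenableWith Real.cos
        (Ioo (k₁ * Real.pi - Real.pi / 2) (k₂ * Real.pi + Real.pi / 2))
        (fun x => -(x * Real.sin x / Real.cos x))
        ((1 + ((max |k₁| |k₂| : ℤ) : ℝ) ^ 2) * Real.pi ^ 2)) ∧
    -- (6) tan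
    (∀ K : Finset ℤ,
      AmenableWith Real.tan
        (⋃ k ∈ K, Ioo ((k : ℝ) * Real.pi - Real.pi / 2) ((k : ℝ) * Real.pi + Real.pi / 2))
        (fun x => 2 * x / Real.sin (2 * x)) 2) ∧
    -- (7) 1 / sin
    (∀ k : ℤ,
      AmenableWith (fun x => 1 / Real.sin x) (Ioo (k * Real.pi) (k * Real.pi + Real.pi))
        (fun x => -(x * Real.cos x / Real.sin x))
        (3 * (1 + |(k : ℝ)|) ^ 2 * Real.pi ^ 2)) ∧
    -- (8) 1 / cos
    (∀ k : ℤ,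
      AmenableWith (fun x => 1 / Real.cos x)
        (Ioo (k * Real.pi - Real.pi / 2) (k * Real.pi + Real.pi / 2))
        (fun x => x * Real.sin x / Real.cos x)
        (3 * (1 / 2 + |(k : ℝ)|) ^ 2 * Real.pi ^ 2)) ∧
    -- (9) cot
    (∀ K : Finset ℤ,
      AmenableWith Real.cot
        (⋃ k ∈ K, Ioo ((k : ℝ) * Real.pi) ((k : ℝ) * Real.pi + Real.pi))
        (fun x => 2 * x / Real.sin (2 * x)) 2) ∧
    -- (10) exp
    AmenableWith Real.exp univ (fun x => x) 1 ∧
    -- (11) log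
    AmenableWith Real.log (Ioi 0) (fun x => 1 / Real.log x) 1 ∧
    -- (12) sinh
    AmenableWith Real.sinh univ (fun x => x * Real.cosh x / Real.sinh x) 1 ∧
    -- (13) cosh
    AmenableWith Real.cosh univ (fun x => x * Real.sinh x / Real.cosh x) 1 ∧
    -- (14) atan
    AmenableWith Real.arctan univ (fun x => x / (x ^ 2 + 1) / Real.arctan x) 1 ∧
    -- (15) asinh
    AmenableWith Real.arsinh univ (fun x => x / √(x ^ 2 + 1) / Real.arsinh x) 1 ∧
    -- (16) acosh
    AmenableWith Real.arcosh (Ioi 1) (fun x => x / √(x ^ 2 - 1) / Real.arcosh x) 2 ∧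
    -- (17) Gamma
    AmenableWith Real.Gamma (Ioi 0) (fun x => x * realDigamma x) 3 ∧
    -- (18) digamma
    AmenableWith realDigamma (Ioi 0) (fun x => x * deriv realDigamma x / realDigamma x) 1 ∧
    -- (19) sin ∘ log
    AmenableWith (fun x => Real.sin (Real.log x)) (Ioi 0)
      (fun x => Real.cos (Real.log x) / Real.sin (Real.log x)) ((1 + √2) / 2) := by
  exact ⟨amenable_and_condFormula_and_hQuot_le_polynomial,
    fun p q hq hpq => ⟨amenable_rational hq hpq, fun hp => condFormula_rational hp hq,
      (exists_abs_hQuot_rational_le p q hq).imp fun _ h x _ => h x⟩,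
    fun _ a α => ⟨amenable_sum_rpow a α, condFormula_sum_rpow a α,
      exists_abs_hQuot_sum_rpow_le a α⟩,
    fun k₁ k₂ _ => amenableWith_sin k₁ k₂, fun k₁ k₂ _ => amenableWith_cos k₁ k₂,
    amenableWith_tan, amenableWith_one_div_sin, amenableWith_one_div_cos, amenableWith_cot,
    amenableWith_exp, amenableWith_log, amenableWith_sinh, amenableWith_cosh, amenableWith_arctan,
    amenableWith_arsinh, amenableWith_arcosh, amenableWith_Gamma, amenableWith_realDigamma,
    amenableWith_sin_log⟩
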